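/- There is a universal constant $C>0$ such that the following holds. Let $n\ge 1$ and $p\ge 2$ be integers, let $k\ge 1$ be a real number, and let $\mathcal U$ be a nonempty finite set. Let $X_{ui}$, $u\in\mathcal U$, $i=1,\dots,n$, be random vectors in $\mathbb R^p$ on a common probability space such that the families $(X_{ui})_{u\in\mathcal U}$, $i=1,\dots,n$, are independent across $i$ (no independence across $u$ and no identical distribution is assumed). Suppose that $$\Big(\mathrm E\Big[\max_{1\le i\le n}\max_{u\in\mathcal U}\|X_{ui}\|_\infty^2\Big]\Big)^{1/2}\le K<\infty .$$ Write $\|\theta\|_0$ for the number of nonzero components of $\theta\in\mathbb R^p$, $\|\theta\|$ for its Euclidean norm, $|\mathcal U|$ for the cardinality of $\mathcal U$, and $\mathbb E_n[a]=n^{-1}\sum_{i=1}^n a_i$, so that $\mathbb E_n\big[(\theta'X_u)^2-\mathrm E[(\theta'X_u)^2]\big]=n^{-1}\sum_{i=1}^n\big((\theta'X_{ui})^2-\mathrm E[(\theta'X_{ui})^2]\big)$ and $\mathbb E_n\mathrm E[(\theta'X_u)^2]=n^{-1}\sum_{i=1}^n\mathrm E[(\theta'X_{ui})^2]$. Define $$\delta_n:=\frac{K\sqrt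 k}{\sqrt n}\Big(\log^{1/2}|\mathcal U|+\log^{1/2}p+(\log k)(\log^{1/2}p)(\log^{1/2}n)\Big).$$ Then the random variable $\sup_{\|\theta\|_0\le k,\,\|\theta\|=1}\max_{u\in\mathcal U}\big|\mathbb E_n\big[(\theta'X_u)^2-\mathrm E[(\theta'X_u)^2]\big]\big|$ is integrable and $$\mathrm E\Big[\sup_{\|\theta\|_0\le k,\,\|\theta\|=1}\ \max_{u\in\mathcal U}\Big|\mathbb E_n\big[(\theta'X_u)^2-\mathrm E[(\theta'X_u)^2]\big]\Big|\Big]\le C\Big(\delta_n^2+\delta_n\sup_{\|\theta\|_0\le k,\,\|\theta\|=1,\,u\in\mathcal U}\sqrt{\mathbb E_n\mathrm E[(\theta'X_u)^2]}\Big).$$ -/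

import Mathlib

open MeasureTheory ProbabilityTheory

noncomputable section

/-- The number of nonzero components `‖θ‖₀` of a vector `θ ∈ ℝᵖ`. -/
def l0norm {p : ℕ} (θ : EuclideanSpace ℝ (Fin p)) : ℕ :=
  Set.ncard {j : Fin p | θ j ≠ 0}

/-- The set of all `θ ∈ ℝᵖ` with `‖θ‖₀ ≤ k` and Euclidean norm `‖θ‖ = 1`. -/
def sparseSphere (p : ℕ) (k : ℝ) : Set (EuclideanSpace ℝ (Fin p)) :=
  {θ | (l0norm θ : ℝ) ≤ k ∧ ‖θ‖ = 1}

/-- The linear form `θ'x`. -/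
def linForm {p : ℕ} (θ : EuclideanSpace ℝ (Fin p)) (x : Fin p → ℝ) : ℝ :=
  ∑ j, θ j * x j

/-- The empirical average `𝔼ₙ[a] = n⁻¹ ∑ᵢ aᵢ`. -/
def empMean {n : ℕ} (a : Fin n → ℝ) : ℝ :=
  (∑ i, a i) / n

/-- The rate `δₙ`; the argument `N` is the cardinality of the index set. -/
def deltaRate (K : ℝ) (k : ℝ) (n p N : ℕ) : ℝ :=
  K * √k / √n *
    (√(Real.log N) + √(Real.log p) + Real.log k * √(Real.log p) * √(Real.log n))

/-- `sup_θ max_u |𝔼ₙ[(θ'X_u)² - E (θ'X_u)²]|` over `k`-sparse unit vectors `θ` and `u : U`,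
as a function of the sample point. The supremum is that of a bounded set of reals whenever
the vectors are square integrable. -/
def sparseDeviation {Ω U : Type*} [MeasurableSpace Ω] (P : Measure Ω) {n p : ℕ} (k : ℝ)
    (X : U → Fin n → Ω → Fin p → ℝ) (ω : Ω) : ℝ :=
  ⨆ θ : sparseSphere p k, ⨆ u : U,
    |empMean fun i => linForm θ.1 (X u i ω) ^ 2 - ∫ ω', linForm θ.1 (X u i ω') ^ 2 ∂P|

end

/-!
The proof follows Rudelson and Vershynin, with every step carried out on finite sets.

For fixed `u` and `ω` the deviation is the supremum over `k`-sparse unit vectors of a quadratic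
form. Let `s = min ⌊k⌋ p`. A union of `1/4`-nets of the unit spheres of the `s`-dimensional
coordinate subspaces has at most `(9 p) ^ s` points, and the supremum is at most twice the maximum
over this net (`exists_finset_net_sparseSphere`), so only a finite maximum has to be estimated.

Symmetrization (`integral_iSup_abs_sub_le_signMean`) replaces the centred sums by
`∑ᵢ εᵢ (θ'X_{ui})²` with independent signs `εᵢ`. Conditionally on the data this is a
subgaussian process. With `M = max ‖X_{ui}‖_∞` and `R² = max_θ,u ∑ᵢ (θ'X_{ui})²`, the distance
between two forms is at most `2 R` times the `ℓ^∞` distance of the vectors `(θ'X_{ui})ᵢ`, so that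
covering numbers in `ℓ^∞` matter. Sparse unit vectors have `ℓ¹` norm at most `√s`, hence are convex
combinations of the `2 p` vectors `± √s e_j`, and Maurey's empirical method approximates them within
`O(√s M 2⁻ʲ)` by averages of `O(4 ^ j log n)` of these vectors (`exists_abs_sum_le_of_weight`,
`exists_approx_linForm`). The random choice in Maurey's argument is replaced by a greedy choice
along an exponential potential. Each of the `O(log s)` links of the chain then costs
`O(√s M R √(log n) √(log p))`, besides a geometric series in `√(log |U|)`. The chain stops at
`2⁻ʲ ≤ 1 / s`, where the cardinality of the net itself, with logarithm `O(s log p)`, is affordable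
for the last link (`signMean_iSup_sq_linForm_le`).

Taking expectations and applying the Cauchy–Schwarz inequality to `E[M R]` bounds the expected
deviation `W` over the net by `O(δₙ √(W + σ²))`, with `σ²` the largest average second moment
(`integral_iSup_net_le`), and this inequality is solved for `W` (`le_of_le_mul_sqrt_add`).
-/

/-! ### Averages over random signs -/

/-- The sign `±1` encoded by a Boolean. -/
noncomputable def signVal (b : Bool) : ℝ := if b then 1 else -1

/-- The average of `F` over all `2 ^ n` sign patterns. -/
noncomputable def signMean {n : ℕ} (F : (Fin n → Bool) → ℝ) : ℝ := (∑ ε, F ε) / 2 ^ n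

/-- The signed sum `∑ᵢ εᵢ aᵢ`. -/
noncomputable def signSum {n : ℕ} (ε : Fin n → Bool) (a : Fin n → ℝ) : ℝ := ∑ i, signVal (ε i) * a i

lemma abs_signVal (b : Bool) : |signVal b| = 1 := by cases b <;> simp [signVal]

lemma signMean_mono {n : ℕ} {F G : (Fin n → Bool) → ℝ} (h : ∀ ε, F ε ≤ G ε) :
    signMean F ≤ signMean G := by
  unfold signMean
  gcongr with ε
  exact h ε

lemma signMean_const (n : ℕ) (c : ℝ) : signMean (fun _ : Fin n → Bool => c) = c := by
  simp [signMean]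

lemma signMean_add {n : ℕ} (F G : (Fin n → Bool) → ℝ) :
    signMean (fun ε => F ε + G ε) = signMean F + signMean G := by
  simp [signMean, Finset.sum_add_distrib, add_div]

lemma signMean_mul_left {n : ℕ} (c : ℝ) (F : (Fin n → Bool) → ℝ) :
    signMean (fun ε => c * F ε) = c * signMean F := by
  simp [signMean, ← Finset.mul_sum, mul_div_assoc]

lemma signMean_sum {n : ℕ} {κ : Type*} (s : Finset κ) (F : κ → (Fin n → Bool) → ℝ) :
    signMean (fun ε => ∑ t ∈ s, F t ε) = ∑ t ∈ s, signMean (F t) := by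
  simp only [signMean]
  rw [Finset.sum_comm, Finset.sum_div]

lemma signMean_nonneg {n : ℕ} {F : (Fin n → Bool) → ℝ} (h : ∀ ε, 0 ≤ F ε) : 0 ≤ signMean F :=
  div_nonneg (Finset.sum_nonneg fun ε _ => h ε) (by positivity)

lemma signSum_sub {n : ℕ} (ε : Fin n → Bool) (a b : Fin n → ℝ) :
    signSum ε (fun i => a i - b i) = signSum ε a - signSum ε b := by
  simp [signSum, mul_sub]

lemma abs_signSum_le {n : ℕ} (ε : Fin n → Bool) (a : Fin n → ℝ) :
    |signSum ε a| ≤ ∑ i, |a i| := by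
  refine (Finset.abs_sum_le_sum_abs _ _).trans_eq ?_
  simp [abs_mul, abs_signVal]

lemma signMean_exp_signSum {n : ℕ} (l : ℝ) (a : Fin n → ℝ) :
    signMean (fun ε => Real.exp (l * signSum ε a)) = ∏ i, Real.cosh (l * a i) := by
  have h : ∀ i, Real.cosh (l * a i) = (∑ b : Bool, Real.exp (l * (signVal b * a i))) / 2 := by
    intro i
    simp [signVal, Real.cosh_eq]
  simp only [h, signMean, signSum, Finset.mul_sum, Real.exp_sum]
  rw [Finset.prod_div_distrib, Finset.prod_univ_sum, Fintype.piFinset_univ]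
  simp

lemma signMean_exp_signSum_le {n : ℕ} (l : ℝ) (a : Fin n → ℝ) :
    signMean (fun ε => Real.exp (l * signSum ε a)) ≤ Real.exp (l ^ 2 * (∑ i, a i ^ 2) / 2) := by
  rw [signMean_exp_signSum]
  calc ∏ i, Real.cosh (l * a i) ≤ ∏ i, Real.exp ((l * a i) ^ 2 / 2) := by
        exact Finset.prod_le_prod (fun i _ => (Real.cosh_pos _).le)
          fun i _ => Real.cosh_le_exp_half_sq _
    _ = _ := by
        rw [← Real.exp_sum]
        congr 1
        rw [Finset.mul_sum, Finset.sum_div]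
        simp [mul_pow]

/-- The maximal inequality for Rademacher sums, with the number of distinct coefficient
vectors `a t` in place of the number of indices `t`. -/
lemma signMean_iSup_abs_signSum_le {n : ℕ} {ι : Type*} [Fintype ι] [Nonempty ι]
    (a : ι → Fin n → ℝ) {σ B : ℝ} (hσ : 0 ≤ σ) (ha : ∀ t, ∑ i, a t i ^ 2 ≤ σ ^ 2)
    (hB : (Set.ncard (Set.range a) : ℝ) ≤ B) :
    signMean (fun ε => ⨆ t, |signSum ε (a t)|) ≤ σ * √(2 * Real.log (2 * B)) := by
  classical
  have hcard : (1 : ℝ) ≤ B := by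
    refine le_trans ?_ hB
    have : 0 < Set.ncard (Set.range a) :=
      (Set.ncard_pos (Set.finite_range a)).2 (Set.range_nonempty a)
    exact_mod_cast this
  rcases hσ.eq_or_lt with rfl | hσ
  · have h0 : ∀ t i, a t i = 0 := by
      intro t i
      have h1 := ha t
      have h2 : a t i ^ 2 ≤ ∑ i, a t i ^ 2 :=
        Finset.single_le_sum (f := fun i => a t i ^ 2) (fun i _ => sq_nonneg _) (Finset.mem_univ i)
      have : a t i ^ 2 ≤ 0 := by linarith [h2, h1]
      exact pow_eq_zero_iff (two_ne_zero) |>.1 (le_antisymm this (sq_nonneg _))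
    simp [signSum, h0, signMean]
  set H := Real.log (2 * B) with hH
  have hHpos : 0 < H := Real.log_pos (by linarith)
  set l := √(2 * H) / σ with hl
  have hlpos : 0 < l := by positivity
  have hl2 : l ^ 2 * σ ^ 2 = 2 * H := by
    rw [hl, div_pow, Real.sq_sqrt (by positivity)]; field_simp
  -- the number `c = 2 B exp (l² σ² / 2)` bounds the mean of `exp (l · max)`
  set S : Finset (Fin n → ℝ) := (Set.finite_range a).toFinset with hS
  have hScard : (S.card : ℝ) ≤ B := by
    rwa [hS, ← Set.ncard_eq_toFinset_card _ (Set.finite_range a)]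
  have hpt : ∀ ε : Fin n → Bool, l * (⨆ t, |signSum ε (a t)|) ≤
      2 * H + (∑ v ∈ S, (Real.exp (l * signSum ε v) + Real.exp ((-l) * signSum ε v))) /
        Real.exp (2 * H) - 1 := by
    intro ε
    obtain ⟨t, ht⟩ := exists_eq_ciSup_of_finite (f := fun t => |signSum ε (a t)|)
    rw [← ht]
    have h1 : Real.exp (l * |signSum ε (a t)|) ≤
        ∑ v ∈ S, (Real.exp (l * signSum ε v) + Real.exp ((-l) * signSum ε v)) := by
      refine le_trans ?_ (Finset.single_le_sum
        (f := fun v => Real.exp (l * signSum ε v) + Real.exp ((-l) * signSum ε v))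
        (fun v _ => by positivity) (show a t ∈ S by simp [hS]))
      rcases abs_cases (signSum ε (a t)) with h | h <;> rw [h.1]
      · linarith [Real.exp_pos ((-l) * signSum ε (a t))]
      · rw [mul_neg, ← neg_mul]; linarith [Real.exp_pos (l * signSum ε (a t))]
    have h2 := Real.add_one_le_exp (l * |signSum ε (a t)| - 2 * H)
    rw [Real.exp_sub] at h2
    have h3 := div_le_div_of_nonneg_right h1 (Real.exp_pos (2 * H)).le
    linarith
  have hmean := signMean_mono hpt
  rw [signMean_mul_left] at hmean
  have hbound : signMean (fun ε : Fin n → Bool =>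
      2 * H + (∑ v ∈ S, (Real.exp (l * signSum ε v) + Real.exp ((-l) * signSum ε v))) /
        Real.exp (2 * H) - 1) ≤ 2 * H := by
    have e : (fun ε : Fin n → Bool =>
      2 * H + (∑ v ∈ S, (Real.exp (l * signSum ε v) + Real.exp ((-l) * signSum ε v))) /
        Real.exp (2 * H) - 1) = fun ε : Fin n → Bool => (2 * H - 1) + (Real.exp (2 * H))⁻¹ *
        (∑ v ∈ S, (Real.exp (l * signSum ε v) + Real.exp ((-l) * signSum ε v))) := by
      ext ε; field_simp; ring
    rw [e, signMean_add, signMean_const, signMean_mul_left, signMean_sum]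
    have : ∑ v ∈ S, signMean (fun ε : Fin n → Bool =>
        Real.exp (l * signSum ε v) + Real.exp ((-l) * signSum ε v)) ≤
        ∑ v ∈ S, 2 * Real.exp H := by
      refine Finset.sum_le_sum fun v hv => ?_
      obtain ⟨t, rfl⟩ : ∃ t, a t = v := by simpa [hS] using hv
      rw [signMean_add]
      have h1 := signMean_exp_signSum_le l (a t)
      have h2 := signMean_exp_signSum_le (-l) (a t)
      have h3 : Real.exp (l ^ 2 * (∑ i, a t i ^ 2) / 2) ≤ Real.exp H := by
        apply Real.exp_le_exp.2
        have := mul_le_mul_of_nonneg_left (ha t) (sq_nonneg l)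
        linarith
      rw [neg_sq] at h2
      linarith
    have h4 : ∑ v ∈ S, 2 * Real.exp H ≤ Real.exp (2 * H) := by
      rw [Finset.sum_const, nsmul_eq_mul, two_mul H, Real.exp_add]
      have : Real.exp H = 2 * B := Real.exp_log (by linarith)
      rw [this]
      nlinarith
    have h5 : (Real.exp (2 * H))⁻¹ * (∑ v ∈ S, signMean (fun ε : Fin n → Bool =>
        Real.exp (l * signSum ε v) + Real.exp ((-l) * signSum ε v))) ≤ 1 := by
      rw [inv_mul_le_iff₀ (Real.exp_pos _), mul_one]
      exact this.trans h4
    linarith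
  have h6 := hmean.trans hbound
  have h7 : σ * √(2 * H) = 2 * H / l := by
    rw [hl]
    have := Real.mul_self_sqrt (show 0 ≤ 2 * H by positivity)
    have h8 : √(2 * H) ≠ 0 := by positivity
    field_simp
    linarith
  rw [h7, le_div_iff₀ hlpos]
  linarith

/-- Chaining for squares: if `g` is reached from `0` through approximations `G j` that are
bounded by `R` in `ℓ²`, the increments of `G ^ 2` are controlled by `2 R` times the increments
of `G` in `ℓ^∞`. -/
lemma signMean_iSup_sq_le_chain {n : ℕ} {ι : Type*} [Fintype ι] [Nonempty ι] (J : ℕ)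
    (G : ℕ → ι → Fin n → ℝ) (hG0 : ∀ t i, G 0 t i = 0) {R : ℝ} (hR : 0 ≤ R)
    (hGR : ∀ j t, ∑ i, G j t i ^ 2 ≤ R ^ 2) (d B : ℕ → ℝ) (hd : ∀ j < J, 0 ≤ d j)
    (hGd : ∀ j < J, ∀ t i, |G (j + 1) t i - G j t i| ≤ d j)
    (hB : ∀ j < J, (Set.ncard (Set.range fun t => (G (j + 1) t, G j t)) : ℝ) ≤ B j) :
    signMean (fun ε => ⨆ t, |signSum ε (fun i => G J t i ^ 2)|) ≤
      ∑ j ∈ Finset.range J, 2 * R * d j * √(2 * Real.log (2 * B j)) := by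
  induction J with
  | zero => simp [hG0, signSum, signMean]
  | succ J ih =>
    rw [Finset.sum_range_succ]
    have ih' := ih (fun j hj => hd j (by omega)) (fun j hj => hGd j (by omega))
      (fun j hj => hB j (by omega))
    have hlink : signMean (fun ε => ⨆ t, |signSum ε (fun i => G (J + 1) t i ^ 2 - G J t i ^ 2)|) ≤
        (2 * R * d J) * √(2 * Real.log (2 * B J)) := by
      refine signMean_iSup_abs_signSum_le _ (by have := hd J (by omega); positivity) ?_ ?_
      · intro t
        have h1 : ∀ i, (G (J + 1) t i ^ 2 - G J t i ^ 2) ^ 2 ≤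
            d J ^ 2 * (2 * G (J + 1) t i ^ 2 + 2 * G J t i ^ 2) := by
          intro i
          have h2 := hGd J (by omega) t i
          have h3 : (G (J + 1) t i - G J t i) ^ 2 ≤ d J ^ 2 := by
            rw [← sq_abs]; gcongr
          calc (G (J + 1) t i ^ 2 - G J t i ^ 2) ^ 2
              = (G (J + 1) t i - G J t i) ^ 2 * (G (J + 1) t i + G J t i) ^ 2 := by ring
            _ ≤ d J ^ 2 * (2 * G (J + 1) t i ^ 2 + 2 * G J t i ^ 2) := by
              gcongr
              nlinarith [sq_nonneg (G (J + 1) t i - G J t i)]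
        calc ∑ i, (G (J + 1) t i ^ 2 - G J t i ^ 2) ^ 2
            ≤ ∑ i, d J ^ 2 * (2 * G (J + 1) t i ^ 2 + 2 * G J t i ^ 2) :=
              Finset.sum_le_sum fun i _ => h1 i
          _ = d J ^ 2 * (2 * ∑ i, G (J + 1) t i ^ 2 + 2 * ∑ i, G J t i ^ 2) := by
              rw [← Finset.mul_sum, Finset.sum_add_distrib, Finset.mul_sum, Finset.mul_sum]
          _ ≤ d J ^ 2 * (2 * R ^ 2 + 2 * R ^ 2) := by
              gcongr
              · exact hGR _ t
              · exact hGR _ t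
          _ = (2 * R * d J) ^ 2 := by ring
      · refine le_trans ?_ (hB J (by omega))
        have : (Set.range fun t => fun i => G (J + 1) t i ^ 2 - G J t i ^ 2) =
            (fun q : (Fin n → ℝ) × (Fin n → ℝ) => fun i => q.1 i ^ 2 - q.2 i ^ 2) ''
              Set.range fun t => (G (J + 1) t, G J t) := by
          rw [← Set.range_comp]; rfl
        rw [this]
        exact_mod_cast Set.ncard_image_le (Set.finite_range _)
    refine le_trans ?_ (add_le_add ih' hlink)
    rw [← signMean_add]
    refine signMean_mono fun ε => ciSup_le fun t => ?_
    have h1 := le_ciSup (Set.finite_range fun t => |signSum ε (fun i => G J t i ^ 2)|).bddAbove t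
    have h2 := le_ciSup (Set.finite_range fun t =>
      |signSum ε (fun i => G (J + 1) t i ^ 2 - G J t i ^ 2)|).bddAbove t
    rw [signSum_sub] at h2
    have h3 := abs_add_le (signSum ε fun i => G J t i ^ 2)
      (signSum ε (fun i => G (J + 1) t i ^ 2) - signSum ε (fun i => G J t i ^ 2))
    rw [add_sub_cancel] at h3
    simp only [signSum_sub] at h2 ⊢
    linarith

/-! ### Empirical approximation of convex combinations -/

/-- Hoeffding's lemma for finitely supported weights. -/
lemma sum_weight_mul_exp_le {I : Type*} [Fintype I] (w y : I → ℝ) (hw : ∀ a, 0 ≤ w a)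
    (hw1 : ∑ a, w a = 1) (hmean : ∑ a, w a * y a = 0) {c : ℝ} (hy : ∀ a, |y a| ≤ c) (l : ℝ) :
    ∑ a, w a * Real.exp (l * y a) ≤ Real.exp ((l * c) ^ 2 / 2) := by
  have hne : Nonempty I := by
    by_contra h
    rw [not_nonempty_iff] at h
    simp at hw1
  have hc : 0 ≤ c := (abs_nonneg _).trans (hy hne.some)
  rcases hc.eq_or_lt with rfl | hc
  · have : ∀ a, y a = 0 := fun a => abs_eq_zero.1 (le_antisymm (hy a) (abs_nonneg _))
    simp [this, hw1]
  have hconv : ∀ a, Real.exp (l * y a) ≤ Real.cosh (l * c) + y a * (Real.sinh (l * c) / c) := by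
    intro a
    have h1 := abs_le.1 (hy a)
    have h3 : -1 ≤ y a / c := by rw [le_div_iff₀ hc]; linarith
    have h4 : y a / c ≤ 1 := by rw [div_le_iff₀ hc]; linarith
    have h2 := convexOn_exp.2 (Set.mem_univ (l * c)) (Set.mem_univ (-(l * c)))
      (show 0 ≤ (1 + y a / c) / 2 by linarith) (show 0 ≤ (1 - y a / c) / 2 by linarith) (by ring)
    simp only [smul_eq_mul] at h2
    rw [show (1 + y a / c) / 2 * (l * c) + (1 - y a / c) / 2 * -(l * c) = l * y a by
      field_simp; ring] at h2
    refine h2.trans_eq ?_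
    rw [Real.cosh_eq, Real.sinh_eq]
    field_simp
    ring
  calc ∑ a, w a * Real.exp (l * y a)
      ≤ ∑ a, w a * (Real.cosh (l * c) + y a * (Real.sinh (l * c) / c)) :=
        Finset.sum_le_sum fun a _ => mul_le_mul_of_nonneg_left (hconv a) (hw a)
    _ = (∑ a, w a) * Real.cosh (l * c) + (∑ a, w a * y a) * (Real.sinh (l * c) / c) := by
        rw [Finset.sum_mul, Finset.sum_mul, ← Finset.sum_add_distrib]
        exact Finset.sum_congr rfl fun a _ => by ring
    _ = Real.cosh (l * c) := by rw [hw1, hmean]; ring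
    _ ≤ _ := Real.cosh_le_exp_half_sq _

/-- Greedy selection for an exponential potential: each new atom is chosen so that the
potential does not exceed its conditional mean. -/
lemma exists_sum_exp_le {I T : Type*} [Fintype I] [Fintype T] (w : I → ℝ) (z : I → T → ℝ)
    (hw : ∀ a, 0 ≤ w a) (hw1 : ∑ a, w a = 1) (hmean : ∀ τ, ∑ a, w a * z a τ = 0) {c : ℝ}
    (hz : ∀ a τ, |z a τ| ≤ c) (l : ℝ) (m : ℕ) :
    ∃ b : Fin m → I, ∑ τ, Real.exp (l * ∑ q, z (b q) τ) ≤
      Fintype.card T * Real.exp (m * ((l * c) ^ 2 / 2)) := by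
  induction m with
  | zero => exact ⟨Fin.elim0, by simp⟩
  | succ m ih =>
    obtain ⟨b, hb⟩ := ih
    have hkey : ∃ a, ∑ τ, Real.exp (l * (∑ q, z (b q) τ + z a τ)) ≤
        Fintype.card T * Real.exp ((m + 1) * ((l * c) ^ 2 / 2)) := by
      by_contra! hcon
      have h1 : ∑ a, w a * ∑ τ, Real.exp (l * (∑ q, z (b q) τ + z a τ)) ≤
          Fintype.card T * Real.exp ((m + 1) * ((l * c) ^ 2 / 2)) := by
        calc ∑ a, w a * ∑ τ, Real.exp (l * (∑ q, z (b q) τ + z a τ))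
            = ∑ τ, Real.exp (l * ∑ q, z (b q) τ) * ∑ a, w a * Real.exp (l * z a τ) := by
              simp only [Finset.mul_sum]
              rw [Finset.sum_comm]
              refine Finset.sum_congr rfl fun τ _ => Finset.sum_congr rfl fun a _ => ?_
              rw [mul_add, Real.exp_add, ← Finset.mul_sum]
              ring
          _ ≤ ∑ τ, Real.exp (l * ∑ q, z (b q) τ) * Real.exp ((l * c) ^ 2 / 2) := by
              refine Finset.sum_le_sum fun τ _ => mul_le_mul_of_nonneg_left ?_ (Real.exp_pos _).le
              exact sum_weight_mul_exp_le w (fun a => z a τ) hw hw1 (hmean τ) (fun a => hz a τ) l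
          _ ≤ (Fintype.card T * Real.exp (m * ((l * c) ^ 2 / 2))) *
                Real.exp ((l * c) ^ 2 / 2) := by
              rw [← Finset.sum_mul]
              exact mul_le_mul_of_nonneg_right hb (Real.exp_pos _).le
          _ = _ := by rw [mul_assoc, ← Real.exp_add]; ring_nf
      have h2 : Fintype.card T * Real.exp ((m + 1) * ((l * c) ^ 2 / 2)) <
          ∑ a, w a * ∑ τ, Real.exp (l * (∑ q, z (b q) τ + z a τ)) := by
        obtain ⟨a₀, -, ha₀⟩ : ∃ a ∈ Finset.univ, 0 < w a :=
          Finset.exists_lt_of_sum_lt (s := Finset.univ) (f := fun _ => (0 : ℝ)) (by simp [hw1])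
        calc _ = ∑ a, w a * (Fintype.card T * Real.exp ((m + 1) * ((l * c) ^ 2 / 2))) := by
              rw [← Finset.sum_mul, hw1, one_mul]
          _ < _ := Finset.sum_lt_sum
              (fun a _ => mul_le_mul_of_nonneg_left (hcon a).le (hw a))
              ⟨a₀, Finset.mem_univ _, mul_lt_mul_of_pos_left (hcon a₀) ha₀⟩
      exact absurd h1 (not_le.2 h2)
    obtain ⟨a, ha⟩ := hkey
    refine ⟨Fin.snoc b a, ?_⟩
    simpa [Fin.sum_univ_castSucc] using ha

/-- Maurey's empirical method in `ℓ^∞`: a centred family has `4 ^ j * h` terms whose sum is of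
order `2 ^ j * h` in all `n` coordinates simultaneously, once `log (2 n) ≤ h`. -/
lemma exists_abs_sum_le_of_weight {I : Type*} [Fintype I] {n : ℕ} (w : I → ℝ)
    (z : I → Fin n → ℝ) (hw : ∀ a, 0 ≤ w a) (hw1 : ∑ a, w a = 1)
    (hmean : ∀ i, ∑ a, w a * z a i = 0) {c : ℝ} (hz : ∀ a i, |z a i| ≤ c) (j h : ℕ)
    (hh : 2 * (n : ℝ) ≤ Real.exp h) :
    ∃ b : Fin (4 ^ j * h) → I, ∀ i, |∑ q, z (b q) i| ≤ 3 / 2 * c * 2 ^ j * h := by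
  have hne : Nonempty I := by
    by_contra hI
    rw [not_nonempty_iff] at hI
    simp at hw1
  rcases isEmpty_or_nonempty (Fin n) with hn | hn
  · exact ⟨fun _ => hne.some, fun i => hn.elim i⟩
  have hc : 0 ≤ c := (abs_nonneg _).trans (hz hne.some hn.some)
  rcases hc.eq_or_lt with rfl | hc
  · have : ∀ a i, z a i = 0 := fun a i => abs_eq_zero.1 (le_antisymm (hz a i) (abs_nonneg _))
    exact ⟨fun _ => hne.some, fun i => by simp [this]⟩
  have hpow : (0 : ℝ) < 2 ^ j := by positivity
  -- `l = 2⁻ʲ / c` balances the cardinality `2 n` against the variance term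
  obtain ⟨b, hb⟩ := exists_sum_exp_le (T := Fin n × Bool) w
    (fun a τ => signVal τ.2 * z a τ.1) hw hw1
    (fun τ => by
      have := hmean τ.1
      calc ∑ a, w a * (signVal τ.2 * z a τ.1) = signVal τ.2 * ∑ a, w a * z a τ.1 := by
            rw [Finset.mul_sum]; exact Finset.sum_congr rfl fun a _ => by ring
        _ = 0 := by rw [this, mul_zero])
    (c := c) (fun a τ => by rw [abs_mul, abs_signVal, one_mul]; exact hz a τ.1)
    ((2 ^ j * c)⁻¹) (4 ^ j * h)
  refine ⟨b, fun i => ?_⟩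
  have hexp : ∀ τ : Fin n × Bool, signVal τ.2 * ∑ q, z (b q) τ.1 ≤ 3 / 2 * c * 2 ^ j * h := by
    intro τ
    have h1 := (Finset.single_le_sum
      (f := fun τ : Fin n × Bool =>
        Real.exp ((2 ^ j * c)⁻¹ * ∑ q, signVal τ.2 * z (b q) τ.1))
      (fun τ _ => (Real.exp_pos _).le) (Finset.mem_univ τ)).trans hb
    have h2 : (Fintype.card (Fin n × Bool) : ℝ) ≤ Real.exp h := by
      simpa [mul_comm] using hh
    have h3 : ((4 ^ j * h : ℕ) : ℝ) * (((2 ^ j * c)⁻¹ * c) ^ 2 / 2) = h / 2 := by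
      have : (4 : ℝ) ^ j = (2 ^ j) ^ 2 := by rw [← pow_mul, mul_comm, pow_mul]; norm_num
      push_cast
      rw [this]
      field_simp
    rw [h3] at h1
    have h4 := h1.trans (mul_le_mul_of_nonneg_right h2 (Real.exp_pos _).le)
    rw [← Real.exp_add, Real.exp_le_exp, ← Finset.mul_sum, inv_mul_le_iff₀ (by positivity)] at h4
    linarith
  rw [abs_le]
  have h1 := hexp (i, true)
  have h2 := hexp (i, false)
  simp only [signVal, if_true, one_mul, Bool.false_eq_true, if_false] at h1 h2
  constructor <;> linarith

/-- A vector with `ℓ¹` norm at most `r` is a convex combination of the vectors `± r e_j`. -/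
lemma exists_weight_linForm {p : ℕ} (hp : 1 ≤ p) (θ : EuclideanSpace ℝ (Fin p)) {r : ℝ}
    (hr : 0 < r) (hθ : ∑ j, |θ j| ≤ r) :
    ∃ w : Fin p × Bool → ℝ, (∀ a, 0 ≤ w a) ∧ ∑ a, w a = 1 ∧
      ∀ x : Fin p → ℝ, ∑ a, w a * (r * signVal a.2 * x a.1) = linForm θ x := by
  have hp' : (0 : ℝ) < p := by exact_mod_cast hp
  refine ⟨fun a => (|θ a.1| + signVal a.2 * θ a.1) / (2 * r) +
    (1 - (∑ j, |θ j|) / r) / (2 * p), ?_, ?_, ?_⟩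
  · intro a
    have h1 : 0 ≤ |θ a.1| + signVal a.2 * θ a.1 := by
      have := neg_abs_le (signVal a.2 * θ a.1)
      rw [abs_mul, abs_signVal, one_mul] at this
      linarith
    have h2 : (∑ j, |θ j|) / r ≤ 1 := by rwa [div_le_one hr]
    have h3 : 0 ≤ 1 - (∑ j, |θ j|) / r := by linarith
    positivity
  · rw [Fintype.sum_prod_type]
    simp only [Fintype.sum_bool, signVal, if_true, Bool.false_eq_true, if_false]
    have : ∀ j, (|θ j| + 1 * θ j) / (2 * r) + (1 - (∑ j, |θ j|) / r) / (2 * p) +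
        ((|θ j| + -1 * θ j) / (2 * r) + (1 - (∑ j, |θ j|) / r) / (2 * p)) =
        |θ j| / r + (1 - (∑ j, |θ j|) / r) / p := by
      intro j; field_simp; ring
    rw [Finset.sum_congr rfl fun j _ => this j, Finset.sum_add_distrib, ← Finset.sum_div]
    simp
    field_simp
    ring
  · intro x
    rw [Fintype.sum_prod_type, linForm]
    refine Finset.sum_congr rfl fun j _ => ?_
    simp only [Fintype.sum_bool, signVal, if_true, Bool.false_eq_true, if_false]
    field_simp
    ring

lemma abs_linForm_le {p : ℕ} (θ : EuclideanSpace ℝ (Fin p)) {r M : ℝ} (hM : 0 ≤ M)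
    (hθ : ∑ j, |θ j| ≤ r) (x : Fin p → ℝ) (hx : ∀ j, |x j| ≤ M) : |linForm θ x| ≤ r * M := by
  calc |linForm θ x| ≤ ∑ l, |θ l * x l| := Finset.abs_sum_le_sum_abs _ _
    _ ≤ ∑ l, |θ l| * M := Finset.sum_le_sum fun l _ => by
        rw [abs_mul]; exact mul_le_mul_of_nonneg_left (hx l) (abs_nonneg _)
    _ ≤ r * M := by
        rw [← Finset.sum_mul]
        exact mul_le_mul_of_nonneg_right hθ hM

/-- Finite approximants of a family of linear forms that belong to the family itself: at scale
`2⁻ʲ` they take at most `|U| (2p) ^ (4 ^ j h)` values. -/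
lemma exists_approx_linForm {p n : ℕ} (hp : 1 ≤ p) {κ U : Type*} [Fintype κ] [Nonempty κ]
    [Fintype U] [Nonempty U] (θ : κ → EuclideanSpace ℝ (Fin p)) {r M : ℝ} (hr : 0 < r)
    (hθ : ∀ q, ∑ j, |θ q j| ≤ r) (x : U → Fin n → Fin p → ℝ)
    (hx : ∀ u i j, |x u i j| ≤ M) (j h : ℕ) (hh : 1 ≤ h) (hhn : 2 * (n : ℝ) ≤ Real.exp h) :
    ∃ A : κ × U → κ × U,
      (Set.ncard (Set.range A) : ℝ) ≤ Fintype.card U * (2 * p) ^ (4 ^ j * h) ∧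
      ∀ t i, |linForm (θ (A t).1) (x (A t).2 i) - linForm (θ t.1) (x t.2 i)| ≤
        6 * (r * M) * (2 ^ j)⁻¹ := by
  classical
  have hlin : ∀ q u i, |linForm (θ q) (x u i)| ≤ r * M := fun q u i =>
    abs_linForm_le _ ((abs_nonneg _).trans (hx u i ⟨0, hp⟩)) (hθ q) _ (hx u i)
  have hcode : ∀ t : κ × U, ∃ b : Fin (4 ^ j * h) → Fin p × Bool, ∀ i,
      |∑ q, (linForm (θ t.1) (x t.2 i) - r * signVal (b q).2 * x t.2 i (b q).1)| ≤
        3 / 2 * (2 * (r * M)) * 2 ^ j * h := by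
    intro t
    obtain ⟨w, hw, hw1, hwx⟩ := exists_weight_linForm hp (θ t.1) hr (hθ t.1)
    refine exists_abs_sum_le_of_weight w
      (fun a i => linForm (θ t.1) (x t.2 i) - r * signVal a.2 * x t.2 i a.1) hw hw1 ?_ ?_ j h hhn
    · intro i
      simp only [mul_sub, Finset.sum_sub_distrib]
      rw [hwx, ← Finset.sum_mul, hw1, one_mul, sub_self]
    · intro a i
      have h1 := hlin t.1 t.2 i
      have h2 : |r * signVal a.2 * x t.2 i a.1| ≤ r * M := by
        rw [abs_mul, abs_mul, abs_signVal, mul_one, abs_of_pos hr]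
        exact mul_le_mul_of_nonneg_left (hx _ _ _) hr.le
      calc _ ≤ |linForm (θ t.1) (x t.2 i)| + |r * signVal a.2 * x t.2 i a.1| := abs_sub _ _
        _ ≤ 2 * (r * M) := by linarith
  choose b hb using hcode
  -- a cell consists of the pairs `(θ, u)` with equal `u` and equal selected atoms
  set code : κ × U → U × (Fin (4 ^ j * h) → Fin p × Bool) := fun t => (t.2, b t) with hcodeDef
  have hrep : ∀ t, code (Function.invFun code (code t)) = code t := fun t =>
    Function.invFun_eq ⟨t, rfl⟩
  refine ⟨fun t => Function.invFun code (code t), ?_, ?_⟩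
  · have h1 : Set.ncard (Set.range fun t => Function.invFun code (code t)) ≤
        Fintype.card (U × (Fin (4 ^ j * h) → Fin p × Bool)) := by
      calc _ ≤ Set.ncard (Set.range (Function.invFun code)) :=
            Set.ncard_le_ncard (by rintro _ ⟨t, rfl⟩; exact ⟨code t, rfl⟩) (Set.finite_range _)
        _ ≤ _ := by
            rw [← Set.image_univ]
            refine (Set.ncard_image_le Set.finite_univ).trans ?_
            rw [Set.ncard_univ, Nat.card_eq_fintype_card]
    have h2 : (Fintype.card (U × (Fin (4 ^ j * h) → Fin p × Bool)) : ℝ) =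
        Fintype.card U * (2 * p) ^ (4 ^ j * h) := by
      simp [mul_comm (p : ℝ) 2]
    rw [← h2]
    exact_mod_cast h1
  · intro t i
    set t' := Function.invFun code (code t) with ht'
    have hc : code t' = code t := hrep t
    have hu : t'.2 = t.2 := congrArg Prod.fst hc
    have hbb : b t' = b t := congrArg Prod.snd hc
    have h1 := hb t i
    have h2 := hb t' i
    rw [hu, hbb] at h2
    simp only [Finset.sum_sub_distrib, Finset.sum_const, Finset.card_univ, Fintype.card_fin,
      nsmul_eq_mul] at h1 h2
    have hm : ((4 ^ j * h : ℕ) : ℝ) = (2 ^ j) ^ 2 * h := by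
      push_cast
      rw [← pow_mul, mul_comm j 2, pow_mul]; norm_num
    rw [hm] at h1 h2
    rw [hu]
    have hpos : (0 : ℝ) < 2 ^ j := by positivity
    have hhpos : (0 : ℝ) < h := by exact_mod_cast hh
    have h3 : (2 ^ j) ^ 2 * h * |linForm (θ t'.1) (x t.2 i) - linForm (θ t.1) (x t.2 i)| ≤
        6 * (r * M) * 2 ^ j * h := by
      nth_rewrite 1 [← abs_of_pos (show (0 : ℝ) < (2 ^ j) ^ 2 * h by positivity)]
      rw [← abs_mul]
      rw [abs_le] at h1 h2 ⊢
      constructor <;> linarith [h1.1, h1.2, h2.1, h2.2]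
    have h4 : (2 ^ j) ^ 2 * h * |linForm (θ t'.1) (x t.2 i) - linForm (θ t.1) (x t.2 i)| ≤
        (2 ^ j) ^ 2 * h * (6 * (r * M) * (2 ^ j)⁻¹) := by
      refine h3.trans_eq ?_
      field_simp
    exact le_of_mul_le_mul_left h4 (by positivity)

/-! ### The Rademacher process of squared sparse linear forms -/

/-- The entropy bound for a single link of the chain. -/
lemma sqrt_log_link_le {N p h j : ℕ} (hN : 1 ≤ N) (hp : 2 ≤ p) (hh : 1 ≤ h) :
    √(2 * Real.log (2 * ((N : ℝ) ^ 2 * (2 * p) ^ (5 * (4 ^ j * h))))) ≤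
      2 * √(Real.log N) + 5 * 2 ^ j * √(h * Real.log p) := by
  have hN' : (0 : ℝ) < N := by exact_mod_cast hN
  have hp' : (2 : ℝ) ≤ p := by exact_mod_cast hp
  have hh' : (1 : ℝ) ≤ h := by exact_mod_cast hh
  have h0 : 0 ≤ Real.log N := Real.log_nonneg (by exact_mod_cast hN)
  have h2p : Real.log 2 ≤ Real.log p := Real.log_le_log (by norm_num) hp'
  have hl2 : 0 < Real.log 2 := Real.log_pos (by norm_num)
  have h4 : (1 : ℝ) ≤ 4 ^ j := one_le_pow₀ (by norm_num)
  have hlog : Real.log (2 * ((N : ℝ) ^ 2 * (2 * p) ^ (5 * (4 ^ j * h)))) =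
      Real.log 2 + (2 * Real.log N + 5 * (4 ^ j * h) * (Real.log 2 + Real.log p)) := by
    rw [Real.log_mul (by norm_num) (by positivity), Real.log_mul (by positivity) (by positivity),
      Real.log_pow, Real.log_pow, Real.log_mul (by norm_num) (by positivity)]
    push_cast
    ring
  have h5 : (1 : ℝ) ≤ 4 ^ j * h := by nlinarith
  have hpow : (4 : ℝ) ^ j = (2 ^ j) ^ 2 := by rw [← pow_mul, mul_comm, pow_mul]; norm_num
  apply Real.sqrt_le_iff.2
  refine ⟨by positivity, ?_⟩
  rw [hlog]
  have h6 : Real.log 2 ≤ 4 ^ j * h * Real.log p := by nlinarith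
  have h7 : 5 * (4 ^ j * (h : ℝ)) * (Real.log 2 + Real.log p) ≤
      10 * (4 ^ j * h * Real.log p) := by
    have := mul_le_mul_of_nonneg_left h2p (show (0 : ℝ) ≤ 4 ^ j * h by positivity)
    linarith
  have h8 : (2 * √(Real.log N) + 5 * 2 ^ j * √(h * Real.log p)) ^ 2 =
      4 * Real.log N + 25 * (4 ^ j * h * Real.log p) +
        20 * 2 ^ j * (√(Real.log N) * √(h * Real.log p)) := by
    have e1 := Real.sq_sqrt h0
    have e2 := Real.sq_sqrt (show 0 ≤ h * Real.log p by
      exact mul_nonneg (by linarith) (by linarith))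
    rw [hpow]
    linear_combination 4 * e1 + 25 * (2 ^ j) ^ 2 * e2
  rw [h8]
  have h9 : 0 ≤ 20 * (2 : ℝ) ^ j * (√(Real.log N) * √(h * Real.log p)) := by positivity
  have h10 : 0 ≤ 4 ^ j * (h : ℝ) * Real.log p := by linarith
  linarith

/-- The entropy bound for the link between the finest approximation and the net itself. -/
lemma sqrt_log_net_le {N p s : ℕ} (hN : 1 ≤ N) (hp : 2 ≤ p) (hs : 1 ≤ s) :
    √(2 * Real.log (2 * ((9 * (p : ℝ)) ^ s * N))) ≤
      2 * √(Real.log N) + 4 * √s * √(Real.log p) := by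
  have hN' : (0 : ℝ) < N := by exact_mod_cast hN
  have hp' : (2 : ℝ) ≤ p := by exact_mod_cast hp
  have hs' : (1 : ℝ) ≤ s := by exact_mod_cast hs
  have h0 : 0 ≤ Real.log N := Real.log_nonneg (by exact_mod_cast hN)
  have h2p : Real.log 2 ≤ Real.log p := Real.log_le_log (by norm_num) hp'
  have hl2 : 0 < Real.log 2 := Real.log_pos (by norm_num)
  have h9 : Real.log 9 ≤ 4 * Real.log 2 := by
    rw [show 4 * Real.log 2 = Real.log (2 ^ 4) by rw [Real.log_pow]; norm_num]
    exact Real.log_le_log (by norm_num) (by norm_num)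
  have hlog : Real.log (2 * ((9 * (p : ℝ)) ^ s * N)) =
      Real.log 2 + (s * (Real.log 9 + Real.log p) + Real.log N) := by
    rw [Real.log_mul (by norm_num) (by positivity), Real.log_mul (by positivity) (by positivity),
      Real.log_pow, Real.log_mul (by norm_num) (by positivity)]
  apply Real.sqrt_le_iff.2
  refine ⟨by positivity, ?_⟩
  rw [hlog]
  have h3 : (s : ℝ) * (Real.log 9 + Real.log p) ≤ s * (5 * Real.log p) :=
    mul_le_mul_of_nonneg_left (by linarith) (by linarith)
  have h4 : Real.log 2 ≤ s * Real.log p := by nlinarith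
  have h8 : (2 * √(Real.log N) + 4 * √s * √(Real.log p)) ^ 2 =
      4 * Real.log N + 16 * (s * Real.log p) +
        16 * (√(Real.log N) * √s * √(Real.log p)) := by
    have e1 := Real.sq_sqrt h0
    have e2 := Real.sq_sqrt (show 0 ≤ Real.log p by linarith)
    have e3 := Real.sq_sqrt (show (0 : ℝ) ≤ s by linarith)
    linear_combination 4 * e1 + 16 * √s ^ 2 * e2 + 16 * Real.log p * e3
  rw [h8]
  have h9 : 0 ≤ 16 * (√(Real.log N) * √s * √(Real.log p)) := by positivity
  nlinarith

lemma sum_range_inv_two_pow_le (J : ℕ) : ∑ j ∈ Finset.range J, ((2 : ℝ) ^ j)⁻¹ ≤ 2 := by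
  have h : ∀ J : ℕ, ∑ j ∈ Finset.range J, ((2 : ℝ) ^ j)⁻¹ = 2 - 2 * (2 ^ J)⁻¹ := by
    intro J
    induction J with
    | zero => simp
    | succ J ih => rw [Finset.sum_range_succ, ih, pow_succ]; field_simp; ring
  rw [h]
  have : (0 : ℝ) ≤ 2 * (2 ^ J)⁻¹ := by positivity
  linarith

/-- The chain has `O(log s)` links. -/
lemma clog_two_le {s : ℕ} (hs : 1 ≤ s) : (Nat.clog 2 s : ℝ) ≤ 3 * Real.log s := by
  rcases hs.eq_or_lt with rfl | hs
  · simp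
  have h1 : 2 ^ (Nat.clog 2 s - 1) < s := by
    simpa using Nat.pow_pred_clog_lt_self (b := 2) (by norm_num) (by omega : 1 < s)
  have h2 : 1 ≤ Nat.clog 2 s := Nat.clog_pos (by norm_num) (by omega)
  have h3 : ((Nat.clog 2 s - 1 : ℕ) : ℝ) * Real.log 2 ≤ Real.log s := by
    rw [← Real.log_pow]
    exact Real.log_le_log (by positivity) (by exact_mod_cast h1.le)
  have h4 : Real.log 2 ≤ Real.log s := Real.log_le_log (by norm_num) (by exact_mod_cast hs)
  rw [Nat.cast_sub h2] at h3
  have h5 := Real.log_two_gt_d9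
  push_cast at h3
  have h6 : 0 ≤ (Nat.clog 2 s : ℝ) := by positivity
  nlinarith

/-- The number of atoms per unit of squared resolution is `O(log n)`. -/
lemma exists_nat_log_two_mul {n : ℕ} (hn : 2 ≤ n) :
    ∃ h : ℕ, 1 ≤ h ∧ 2 * (n : ℝ) ≤ Real.exp h ∧ √(h : ℝ) ≤ 2 * √(Real.log n) := by
  have hn' : (2 : ℝ) ≤ n := by exact_mod_cast hn
  have h2n : Real.log 2 ≤ Real.log n := Real.log_le_log (by norm_num) hn'
  have hl2 := Real.log_two_gt_d9
  have h0 : 0 < Real.log (2 * n) := Real.log_pos (by linarith)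
  refine ⟨⌈Real.log (2 * n)⌉₊, Nat.ceil_pos.2 h0, ?_, ?_⟩
  · rw [← Real.log_le_iff_le_exp (by linarith)]
    exact Nat.le_ceil _
  · have h1 := (Nat.ceil_lt_add_one h0.le).le
    rw [Real.log_mul (by norm_num) (by linarith)] at h1
    rw [show 2 * √(Real.log n) = √(4 * Real.log n) by
      rw [Real.sqrt_mul (by norm_num), show (4 : ℝ) = 2 ^ 2 by norm_num, Real.sqrt_sq (by norm_num)]]
    apply Real.sqrt_le_sqrt
    rw [Real.log_mul (by norm_num) (by linarith)]
    linarith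

/-- The Rudelson–Vershynin entropy bound: conditionally on the data, the mean of the Rademacher
process of squared linear forms over a net of unit `s`-sparse vectors. -/
lemma signMean_iSup_sq_linForm_le {p n s : ℕ} (hp : 2 ≤ p) (hn : 1 ≤ n) (hs : 1 ≤ s)
    {κ U : Type*} [Fintype κ] [Nonempty κ] [Fintype U] [Nonempty U]
    (θ : κ → EuclideanSpace ℝ (Fin p)) (hθ : ∀ q, ∑ j, |θ q j| ≤ √s)
    (hκ : Fintype.card κ ≤ (9 * p) ^ s) (x : U → Fin n → Fin p → ℝ) {M R : ℝ}
    (hM : 0 ≤ M) (hR : 0 ≤ R) (hx : ∀ u i j, |x u i j| ≤ M)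
    (hxR : ∀ q u, ∑ i, linForm (θ q) (x u i) ^ 2 ≤ R ^ 2) :
    signMean (fun ε => ⨆ t : κ × U, |signSum ε (fun i => linForm (θ t.1) (x t.2 i) ^ 2)|) ≤
      540 * (√s * M * R) * (√(Real.log (Fintype.card U)) + √(Real.log p) +
        Real.log s * √(Real.log p) * √(Real.log n)) := by
  set N := Fintype.card U with hNdef
  have hN : 1 ≤ N := Fintype.card_pos
  have hs' : (1 : ℝ) ≤ s := by exact_mod_cast hs
  have hp' : (2 : ℝ) ≤ p := by exact_mod_cast hp
  have hlogs : 0 ≤ Real.log s := Real.log_nonneg hs'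
  set a := √s * M with ha
  have ha0 : 0 ≤ a := by positivity
  have hg : ∀ (t : κ × U) i, |linForm (θ t.1) (x t.2 i)| ≤ a := fun t i =>
    abs_linForm_le _ hM (hθ _) _ (hx _ _)
  have hl2 := Real.log_two_gt_d9
  have hlogp : Real.log 2 ≤ Real.log p := Real.log_le_log (by norm_num) hp'
  rcases hn.eq_or_lt with rfl | hn
  · -- a single observation: `|ε y²| = |y| |y| ≤ a R`
    have h1 : ∀ ε : Fin 1 → Bool,
        (⨆ t : κ × U, |signSum ε (fun i => linForm (θ t.1) (x t.2 i) ^ 2)|) ≤ a * R := by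
      intro ε
      refine ciSup_le fun t => (abs_signSum_le _ _).trans ?_
      have h2 := hxR t.1 t.2
      simp only [Fin.sum_univ_one, Fin.isValue, abs_pow] at h2 ⊢
      have h3 := abs_le_of_sq_le_sq h2 hR
      rw [sq]
      exact mul_le_mul (hg t 0) h3 (abs_nonneg _) ha0
    refine (signMean_mono h1).trans ?_
    rw [signMean_const]
    have h4 : 1 / 2 ≤ √(Real.log p) := by
      apply Real.le_sqrt_of_sq_le; norm_num; linarith
    have h5 : 0 ≤ √(Real.log N) := Real.sqrt_nonneg _
    simp only [Nat.cast_one, Real.log_one, Real.sqrt_zero, mul_zero, add_zero]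
    have h6 : 0 ≤ a * R := by positivity
    nlinarith
  obtain ⟨h, hh1, hhn, hhlog⟩ := exists_nat_log_two_mul hn
  set J := Nat.clog 2 s with hJ
  have hJs : s ≤ 2 ^ J := Nat.le_pow_clog (by norm_num) s
  choose A hAcard hAapp using fun j => exists_approx_linForm (n := n) (by omega : 1 ≤ p) θ
    (show 0 < √(s : ℝ) by positivity) hθ x hx j h hh1 hhn
  set g : κ × U → Fin n → ℝ := fun t i => linForm (θ t.1) (x t.2 i) with hgdef
  -- `0` at level `0`, cell representatives at levels `1, …, J`, the forms themselves beyond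
  set G : ℕ → κ × U → Fin n → ℝ := fun j t =>
    if j = 0 then 0 else if j ≤ J then g (A j t) else g t with hG
  have hGsum : ∀ j t, ∑ i, G j t i ^ 2 ≤ R ^ 2 := by
    intro j t
    simp only [hG]
    split_ifs
    · simp; positivity
    · exact hxR _ _
    · exact hxR _ _
  have hGapp : ∀ j t i, |G j t i - g t i| ≤ 6 * a * (2 ^ j)⁻¹ := by
    intro j t i
    simp only [hG]
    split_ifs with h0 h1
    · subst h0
      simp only [Pi.zero_apply, zero_sub, abs_neg, pow_zero, inv_one, mul_one]
      linarith [hg t i]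
    · exact hAapp j t i
    · simp; positivity
  -- consecutive levels differ by at most `6 a 2⁻ʲ + 6 a 2⁻⁽ʲ⁺¹⁾ = 9 a 2⁻ʲ`
  have hGd : ∀ j < J + 1, ∀ t i, |G (j + 1) t i - G j t i| ≤ 9 * a * (2 ^ j)⁻¹ := by
    intro j _ t i
    have h1 := hGapp j t i
    have h2 := hGapp (j + 1) t i
    have h3 : 6 * a * ((2 : ℝ) ^ (j + 1))⁻¹ = 3 * a * (2 ^ j)⁻¹ := by
      rw [pow_succ]; field_simp; ring
    rw [h3] at h2
    rw [abs_le] at h1 h2 ⊢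
    constructor <;> linarith [h1.1, h1.2, h2.1, h2.2]
  have hGcard : ∀ j ≤ J, (Set.ncard (Set.range (G j)) : ℝ) ≤ N * (2 * p) ^ (4 ^ j * h) := by
    intro j hj
    simp only [hG]
    split_ifs with h0
    · have h1 : Set.ncard (Set.range fun _ : κ × U => (0 : Fin n → ℝ)) = 1 := by
        rw [Set.range_const, Set.ncard_singleton]
      have h2 : (1 : ℝ) ≤ N := by exact_mod_cast hN
      have h3 : (1 : ℝ) ≤ (2 * p) ^ (4 ^ j * h) := one_le_pow₀ (by linarith)
      rw [h1]
      push_cast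
      nlinarith
    · refine le_trans ?_ (hAcard j)
      rw [show (fun t => g (A j t)) = g ∘ A j from rfl, Set.range_comp]
      exact_mod_cast Set.ncard_image_le (Set.finite_range _)
  set B : ℕ → ℝ := fun j =>
    if j < J then (N : ℝ) ^ 2 * (2 * p) ^ (5 * (4 ^ j * h)) else (9 * (p : ℝ)) ^ s * N with hB
  have hBcard : ∀ j < J + 1,
      (Set.ncard (Set.range fun t => (G (j + 1) t, G j t)) : ℝ) ≤ B j := by
    intro j hj
    simp only [hB]
    split_ifs with hjJ
    · have h1 : Set.ncard (Set.range fun t => (G (j + 1) t, G j t)) ≤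
          Set.ncard (Set.range (G (j + 1))) * Set.ncard (Set.range (G j)) := by
        rw [← Set.ncard_prod]
        refine Set.ncard_le_ncard ?_ ((Set.finite_range _).prod (Set.finite_range _))
        rintro _ ⟨t, rfl⟩
        exact ⟨⟨t, rfl⟩, ⟨t, rfl⟩⟩
      calc (Set.ncard (Set.range fun t => (G (j + 1) t, G j t)) : ℝ)
          ≤ Set.ncard (Set.range (G (j + 1))) * Set.ncard (Set.range (G j)) := by
            exact_mod_cast h1
        _ ≤ (N * (2 * p) ^ (4 ^ (j + 1) * h)) * (N * (2 * p) ^ (4 ^ j * h)) := by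
            have := hGcard (j + 1) (by omega)
            have := hGcard j (by omega)
            gcongr
        _ = _ := by
            rw [show 5 * (4 ^ j * h) = 4 ^ (j + 1) * h + 4 ^ j * h by ring, pow_add]
            ring
    · have h1 : Set.ncard (Set.range fun t => (G (j + 1) t, G j t)) ≤ Fintype.card (κ × U) := by
        rw [← Set.image_univ]
        refine (Set.ncard_image_le Set.finite_univ).trans ?_
        rw [Set.ncard_univ, Nat.card_eq_fintype_card]
      rw [Fintype.card_prod] at h1
      exact_mod_cast h1.trans (Nat.mul_le_mul_right _ hκ)
  have hchain := signMean_iSup_sq_le_chain (J + 1) G (by simp [hG]) hR hGsum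
    (fun j => 9 * a * (2 ^ j)⁻¹) B (fun j _ => by positivity) hGd hBcard
  have hGlast : ∀ t, G (J + 1) t = g t := by
    intro t; simp [hG]
  simp only [hGlast] at hchain
  refine hchain.trans ?_
  rw [Finset.sum_range_succ]
  have hlink : ∀ j ∈ Finset.range J, 2 * R * (9 * a * (2 ^ j)⁻¹) * √(2 * Real.log (2 * B j)) ≤
      36 * (a * R) * √(Real.log N) * (2 ^ j)⁻¹ +
        180 * (a * R) * (√(Real.log n) * √(Real.log p)) := by
    intro j hj
    have hBj : B j = (N : ℝ) ^ 2 * (2 * p) ^ (5 * (4 ^ j * h)) := by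
      simp [hB, Finset.mem_range.1 hj]
    rw [hBj]
    calc _ ≤ 2 * R * (9 * a * (2 ^ j)⁻¹) *
          (2 * √(Real.log N) + 5 * 2 ^ j * √(h * Real.log p)) := by
          have := sqrt_log_link_le (j := j) hN hp hh1
          gcongr
      _ = 36 * (a * R) * √(Real.log N) * (2 ^ j)⁻¹ +
            90 * (a * R) * (√h * √(Real.log p)) := by
          rw [Real.sqrt_mul (by positivity)]; field_simp; ring
      _ ≤ 36 * (a * R) * √(Real.log N) * (2 ^ j)⁻¹ +
            90 * (a * R) * ((2 * √(Real.log n)) * √(Real.log p)) := by gcongr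
      _ = _ := by ring
  have hsum := Finset.sum_le_sum hlink
  rw [Finset.sum_add_distrib, ← Finset.mul_sum, Finset.sum_const, Finset.card_range,
    nsmul_eq_mul] at hsum
  -- the last link pays for the whole net, of log-cardinality `O(s log p)`, at scale `2⁻ᴶ ≤ 1 / s`
  have hlast : 2 * R * (9 * a * (2 ^ J)⁻¹) * √(2 * Real.log (2 * B J)) ≤
      36 * (a * R) * √(Real.log N) + 72 * (a * R) * √(Real.log p) := by
    have hBJ : B J = (9 * (p : ℝ)) ^ s * N := by simp [hB]
    rw [hBJ]
    have h1 : ((2 : ℝ) ^ J)⁻¹ ≤ 1 := inv_le_one_of_one_le₀ (one_le_pow₀ (by norm_num))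
    have h2 : ((2 : ℝ) ^ J)⁻¹ * √s ≤ 1 := by
      rw [inv_mul_le_one₀ (by positivity)]
      calc √(s : ℝ) ≤ s := by
            rw [Real.sqrt_le_left (by linarith)]; nlinarith
        _ ≤ 2 ^ J := by exact_mod_cast hJs
    calc _ ≤ 2 * R * (9 * a * (2 ^ J)⁻¹) * (2 * √(Real.log N) + 4 * √s * √(Real.log p)) := by
          have := sqrt_log_net_le hN hp hs
          gcongr
      _ = 36 * (a * R) * √(Real.log N) * (2 ^ J)⁻¹ +
            72 * (a * R) * √(Real.log p) * ((2 ^ J)⁻¹ * √s) := by ring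
      _ ≤ 36 * (a * R) * √(Real.log N) * 1 + 72 * (a * R) * √(Real.log p) * 1 := by gcongr
      _ = _ := by ring
  have hJ3 : (J : ℝ) ≤ 3 * Real.log s := clog_two_le hs
  have h36 : 36 * (a * R) * √(Real.log N) * ∑ j ∈ Finset.range J, ((2 : ℝ) ^ j)⁻¹ ≤
      36 * (a * R) * √(Real.log N) * 2 := by
    have := sum_range_inv_two_pow_le J
    gcongr
  have hJJ : J * (180 * (a * R) * (√(Real.log n) * √(Real.log p))) ≤
      3 * Real.log s * (180 * (a * R) * (√(Real.log n) * √(Real.log p))) := by gcongr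
  have e1 : 0 ≤ (a * R) * √(Real.log N) := by positivity
  have e2 : 0 ≤ (a * R) * √(Real.log p) := by positivity
  calc _ ≤ _ := add_le_add hsum hlast
    _ ≤ _ := by linarith

/-! ### A finite net of the sparse sphere -/

/-- Volume comparison: a `1/4`-separated subset of the unit ball has at most `9 ^ d` points. -/
lemma card_le_nine_pow_of_separated {E : Type*} [NormedAddCommGroup E] [NormedSpace ℝ E]
    [FiniteDimensional ℝ E] (s : Finset E) (hs : ∀ c ∈ s, ‖c‖ ≤ 1)
    (h : ∀ c ∈ s, ∀ d ∈ s, c ≠ d → 1 / 4 ≤ ‖c - d‖) : s.card ≤ 9 ^ Module.finrank ℝ E := by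
  borelize E
  let μ : Measure E := Measure.addHaar
  have D : Set.Pairwise (s : Set E) (Function.onFun Disjoint fun c => Metric.ball c (1 / 8)) := by
    rintro c hc d hd hcd
    apply Metric.ball_disjoint_ball
    rw [dist_eq_norm]
    refine le_trans ?_ (h c hc d hd hcd)
    norm_num
  have hsub : (⋃ c ∈ s, Metric.ball c (1 / 8)) ⊆ Metric.ball (0 : E) (9 / 8) := by
    refine Set.iUnion₂_subset fun x hx => ?_
    apply Metric.ball_subset_ball'
    rw [dist_zero_right]
    linarith [hs x hx]
  have hvol : (s.card : ENNReal) * ENNReal.ofReal ((1 / 8) ^ Module.finrank ℝ E) *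
      μ (Metric.ball 0 1) ≤
      ENNReal.ofReal ((9 / 8) ^ Module.finrank ℝ E) * μ (Metric.ball 0 1) := by
    calc _ = μ (⋃ c ∈ s, Metric.ball c (1 / 8)) := by
          rw [measure_biUnion_finset D fun c _ => measurableSet_ball]
          simp only [μ.addHaar_ball_of_pos _ (show (0 : ℝ) < 1 / 8 by norm_num)]
          simp only [Finset.sum_const, nsmul_eq_mul, mul_assoc]
      _ ≤ μ (Metric.ball (0 : E) (9 / 8)) := measure_mono hsub
      _ = _ := by simp only [μ.addHaar_ball_of_pos _ (show (0 : ℝ) < 9 / 8 by norm_num)]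
  have hvol' : (s.card : ENNReal) * ENNReal.ofReal ((1 / 8) ^ Module.finrank ℝ E) ≤
      ENNReal.ofReal ((9 / 8) ^ Module.finrank ℝ E) :=
    (ENNReal.mul_le_mul_iff_left (Metric.measure_ball_pos _ _ zero_lt_one).ne'
      measure_ball_lt_top.ne).1 hvol
  have h1 := ENNReal.toReal_le_of_le_ofReal (by positivity) hvol'
  rw [ENNReal.toReal_mul, ENNReal.toReal_natCast, ENNReal.toReal_ofReal (by positivity),
    div_pow, div_pow, one_pow, mul_one_div, div_le_div_iff_of_pos_right (by positivity)] at h1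
  exact_mod_cast h1

lemma exists_finset_net_sphere (E : Type*) [NormedAddCommGroup E] [NormedSpace ℝ E]
    [FiniteDimensional ℝ E] :
    ∃ S : Finset E, S.card ≤ 9 ^ Module.finrank ℝ E ∧ (∀ c ∈ S, ‖c‖ = 1) ∧
      ∀ v : E, ‖v‖ = 1 → ∃ c ∈ S, ‖v - c‖ ≤ 1 / 4 := by
  classical
  let Q : Finset E → Prop := fun S =>
    (∀ c ∈ S, ‖c‖ = 1) ∧ ∀ c ∈ S, ∀ d ∈ S, c ≠ d → 1 / 4 ≤ ‖c - d‖
  have hcard : ∀ S, Q S → S.card ≤ 9 ^ Module.finrank ℝ E := fun S hS =>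
    card_le_nine_pow_of_separated S (fun c hc => (hS.1 c hc).le) hS.2
  -- a separated set of maximal cardinality is a net
  have hbdd : BddAbove {m | ∃ S, Q S ∧ S.card = m} :=
    ⟨9 ^ Module.finrank ℝ E, by rintro m ⟨S, hS, rfl⟩; exact hcard S hS⟩
  obtain ⟨S, hS, hSm⟩ := Nat.sSup_mem (s := {m | ∃ S, Q S ∧ S.card = m})
    ⟨0, ∅, ⟨by simp, by simp⟩, rfl⟩ hbdd
  refine ⟨S, hcard S hS, hS.1, fun v hv => ?_⟩
  by_contra! hcon
  have hvS : v ∉ S := fun hmem => by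
    have := hcon v hmem
    simp at this
    linarith
  have hQ : Q (insert v S) := by
    refine ⟨?_, ?_⟩
    · intro c hc
      rcases Finset.mem_insert.1 hc with rfl | hc
      · exact hv
      · exact hS.1 c hc
    · intro c hc d hd hcd
      rcases Finset.mem_insert.1 hc with hc' | hc' <;>
        rcases Finset.mem_insert.1 hd with hd' | hd'
      · exact absurd (hc'.trans hd'.symm) hcd
      · rw [hc']; exact (hcon d hd').le
      · rw [norm_sub_rev, hd']; exact (hcon c hc').le
      · exact hS.2 c hc' d hd' hcd
  have := le_csSup hbdd ⟨_, hQ, rfl⟩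
  rw [Finset.card_insert_of_notMem hvS, ← hSm] at this
  omega

/-- A quadratic form is controlled on the unit sphere by its values on a `1/4`-net. -/
lemma abs_bilin_le_of_net {E : Type*} [NormedAddCommGroup E] [InnerProductSpace ℝ E]
    (b : E →ₗ[ℝ] E →ₗ[ℝ] ℝ) (hb : ∀ v w, b v w = b w v) {Q₀ m : ℝ}
    (hQ₀ : ∀ v, ‖v‖ = 1 → |b v v| ≤ Q₀) (S : Finset E) (hS1 : ∀ c ∈ S, ‖c‖ = 1)
    (hS : ∀ v : E, ‖v‖ = 1 → ∃ c ∈ S, ‖v - c‖ ≤ 1 / 4) (hm : ∀ c ∈ S, |b c c| ≤ m)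
    (v : E) (hv : ‖v‖ = 1) : |b v v| ≤ 2 * m := by
  set W : Set ℝ := {r | ∃ v : E, ‖v‖ = 1 ∧ r = |b v v|} with hW
  have hWb : BddAbove W := ⟨Q₀, by rintro _ ⟨v, hv, rfl⟩; exact hQ₀ v hv⟩
  set Q := sSup W with hQ
  have hQle : ∀ v : E, ‖v‖ = 1 → |b v v| ≤ Q := fun v hv => le_csSup hWb ⟨v, hv, rfl⟩
  have hQnn : 0 ≤ Q := (abs_nonneg _).trans (hQle v hv)
  have hhom : ∀ w : E, |b w w| ≤ Q * ‖w‖ ^ 2 := by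
    intro w
    rcases eq_or_ne w 0 with rfl | hw
    · simp
    have hw' : ‖w‖ ≠ 0 := norm_ne_zero_iff.2 hw
    have h1 := hQle (‖w‖⁻¹ • w) (by rw [norm_smul, norm_inv, norm_norm, inv_mul_cancel₀ hw'])
    simp only [map_smul, LinearMap.smul_apply, smul_eq_mul, abs_mul, abs_inv, abs_norm] at h1
    have hpos : 0 < ‖w‖ := norm_pos_iff.2 hw
    rw [← mul_assoc, ← mul_inv, inv_mul_le_iff₀ (by positivity)] at h1
    linarith
  -- polarization, with the small factor `w` scaled by `8` to balance the two norms
  have hpol : ∀ w y : E, ‖w‖ ≤ 1 / 4 → ‖y‖ ≤ 2 → |b w y| ≤ Q / 2 := by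
    intro w y hw hy
    have h1 : 32 * b w y = b ((8 : ℝ) • w + y) ((8 : ℝ) • w + y) -
        b ((8 : ℝ) • w - y) ((8 : ℝ) • w - y) := by
      simp only [map_add, map_sub, map_smul, LinearMap.add_apply, LinearMap.sub_apply,
        LinearMap.smul_apply, smul_eq_mul]
      rw [hb y w]; ring
    have h2 := hhom ((8 : ℝ) • w + y)
    have h3 := hhom ((8 : ℝ) • w - y)
    have h4 := parallelogram_law_with_norm ℝ ((8 : ℝ) • w) y
    have h5 : ‖(8 : ℝ) • w‖ ≤ 2 := by
      rw [norm_smul]; norm_num; linarith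
    have h6 : ‖(8 : ℝ) • w‖ * ‖(8 : ℝ) • w‖ ≤ 2 * 2 :=
      mul_le_mul h5 h5 (norm_nonneg _) (by norm_num)
    have h7 : ‖y‖ * ‖y‖ ≤ 2 * 2 := mul_le_mul hy hy (norm_nonneg _) (by norm_num)
    have h8 : Q * ‖(8 : ℝ) • w + y‖ ^ 2 + Q * ‖(8 : ℝ) • w - y‖ ^ 2 ≤ Q * 16 := by
      rw [← mul_add]
      apply mul_le_mul_of_nonneg_left _ hQnn
      nlinarith
    rw [abs_le] at h2 h3 ⊢
    constructor <;> linarith [h2.1, h2.2, h3.1, h3.2]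
  have hstep : ∀ v : E, ‖v‖ = 1 → |b v v| ≤ m + Q / 2 := by
    intro v hv
    obtain ⟨c, hc, hvc⟩ := hS v hv
    have h1 : b v v = b c c + b (v - c) (v + c) := by
      simp only [map_add, map_sub, LinearMap.sub_apply]
      rw [hb v c]; ring
    have h2 := hpol (v - c) (v + c) hvc (by
      have := norm_add_le v c
      rw [hv, hS1 c hc] at this
      linarith)
    rw [h1]
    exact (abs_add_le _ _).trans (add_le_add (hm c hc) h2)
  have hQm : Q ≤ m + Q / 2 := csSup_le ⟨_, v, hv, rfl⟩ (by rintro _ ⟨v, hv, rfl⟩; exact hstep v hv)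
  have := hQle v hv
  linarith

/-- The vectors of `ℝᵖ` supported in `T`. -/
def coordSubspace {p : ℕ} (T : Finset (Fin p)) : Submodule ℝ (EuclideanSpace ℝ (Fin p)) where
  carrier := {θ | ∀ j ∉ T, θ j = 0}
  add_mem' := by
    intro a b ha hb j hj
    simp [ha j hj, hb j hj]
  zero_mem' := by simp
  smul_mem' := by
    intro c a ha j hj
    simp [ha j hj]

lemma finrank_coordSubspace_le {p : ℕ} (T : Finset (Fin p)) :
    Module.finrank ℝ (coordSubspace T) ≤ T.card := by
  let L : coordSubspace T →ₗ[ℝ] (T → ℝ) :=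
    { toFun := fun v j => v.1 j.1
      map_add' := by intro v w; rfl
      map_smul' := by intro c v; rfl }
  have hL : Function.Injective L := by
    intro v w hvw
    ext j
    by_cases hj : j ∈ T
    · exact congrFun hvw ⟨j, hj⟩
    · rw [v.2 j hj, w.2 j hj]
  simpa using LinearMap.finrank_le_finrank_of_injective hL

lemma l0norm_le_card_of_mem_coordSubspace {p : ℕ} {T : Finset (Fin p)}
    {θ : EuclideanSpace ℝ (Fin p)} (hθ : θ ∈ coordSubspace T) : l0norm θ ≤ T.card := by
  rw [l0norm, ← Set.ncard_coe_finset]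
  refine Set.ncard_le_ncard (fun j hj => ?_) (Finset.finite_toSet _)
  by_contra hjT
  exact hj (hθ j hjT)

lemma sparseSphere_nonempty {p : ℕ} {k : ℝ} (hp : 1 ≤ p) (hk : 1 ≤ k) :
    (sparseSphere p k).Nonempty := by
  refine ⟨EuclideanSpace.single (⟨0, hp⟩ : Fin p) (1 : ℝ), ?_, by simp⟩
  have h : EuclideanSpace.single (⟨0, hp⟩ : Fin p) (1 : ℝ) ∈ coordSubspace {⟨0, hp⟩} := by
    intro j hj
    simp at hj
    simp [hj]
  have := l0norm_le_card_of_mem_coordSubspace h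
  rw [Finset.card_singleton] at this
  exact le_trans (by exact_mod_cast this) hk

lemma sum_abs_le_of_mem_sparseSphere {p : ℕ} {k : ℝ}
    {θ : EuclideanSpace ℝ (Fin p)} (hθ : θ ∈ sparseSphere p k) :
    ∑ j, |θ j| ≤ √(min ⌊k⌋₊ p : ℕ) := by
  classical
  set T : Finset (Fin p) := Finset.univ.filter fun j => θ j ≠ 0 with hT
  have hTl : l0norm θ = T.card := by
    rw [l0norm, ← Set.ncard_coe_finset]; simp [hT]
  have hTs : T.card ≤ min ⌊k⌋₊ p := by
    refine le_min ?_ (by simpa using Finset.card_le_univ T)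
    rw [← hTl]
    exact Nat.le_floor hθ.1
  have hsum : ∑ j, |θ j| = ∑ j ∈ T, |θ j| := by
    symm
    apply Finset.sum_subset (Finset.subset_univ _)
    intro j _ hj
    simp [hT] at hj
    simp [hj]
  have hnorm : ∑ j ∈ T, |θ j| ^ 2 ≤ 1 := by
    have h1 := EuclideanSpace.norm_sq_eq θ
    rw [hθ.2] at h1
    calc ∑ j ∈ T, |θ j| ^ 2 ≤ ∑ j, |θ j| ^ 2 :=
          Finset.sum_le_sum_of_subset_of_nonneg (Finset.subset_univ _) fun _ _ _ => by positivity
      _ = 1 := by simpa using h1.symm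
  rw [hsum]
  apply Real.le_sqrt_of_sq_le
  calc (∑ j ∈ T, |θ j|) ^ 2 ≤ T.card * ∑ j ∈ T, |θ j| ^ 2 := sq_sum_le_card_mul_sum_sq
    _ ≤ T.card * 1 := by gcongr
    _ ≤ _ := by rw [mul_one]; exact_mod_cast hTs

/-- The sparse sphere contains a finite set of size `(9 p) ^ s`, `s = min ⌊k⌋ p`, on which
every quadratic form attains half of its supremum over the sparse sphere. -/
lemma exists_finset_net_sparseSphere {p : ℕ} {k : ℝ} (hp : 1 ≤ p) (hk : 1 ≤ k) :
    ∃ S : Finset (EuclideanSpace ℝ (Fin p)), S.Nonempty ∧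
      S.card ≤ (9 * p) ^ (min ⌊k⌋₊ p) ∧ (∀ c ∈ S, c ∈ sparseSphere p k) ∧
      ∀ (b : EuclideanSpace ℝ (Fin p) →ₗ[ℝ] EuclideanSpace ℝ (Fin p) →ₗ[ℝ] ℝ) (Q₀ m : ℝ),
        (∀ v w, b v w = b w v) → (∀ θ ∈ sparseSphere p k, |b θ θ| ≤ Q₀) →
        (∀ c ∈ S, |b c c| ≤ m) → ∀ θ ∈ sparseSphere p k, |b θ θ| ≤ 2 * m := by
  classical
  set s := min ⌊k⌋₊ p with hs
  have hsp : s ≤ p := min_le_right _ _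
  have hsk : (s : ℝ) ≤ k :=
    le_trans (by exact_mod_cast min_le_left _ _) (Nat.floor_le (by linarith))
  choose net hcard hnorm hcov using fun T : Finset (Fin p) =>
    exists_finset_net_sphere (coordSubspace T)
  set S : Finset (EuclideanSpace ℝ (Fin p)) :=
    (Finset.univ.powersetCard s).biUnion fun T => (net T).image Subtype.val with hS
  have hmem : ∀ T : Finset (Fin p), T.card = s → ∀ v : coordSubspace T, ‖v‖ = 1 →
      v.1 ∈ sparseSphere p k := by
    intro T hT v hv
    refine ⟨?_, hv⟩
    have h1 := l0norm_le_card_of_mem_coordSubspace v.2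
    rw [hT] at h1
    exact le_trans (by exact_mod_cast h1) hsk
  have hext : ∀ θ ∈ sparseSphere p k, ∃ T : Finset (Fin p), T.card = s ∧ θ ∈ coordSubspace T := by
    intro θ hθ
    set T₀ : Finset (Fin p) := Finset.univ.filter fun j => θ j ≠ 0 with hT₀
    have hTl : l0norm θ = T₀.card := by
      rw [l0norm, ← Set.ncard_coe_finset]; simp [hT₀]
    have hTs : T₀.card ≤ s := by
      refine le_min ?_ (by simpa using Finset.card_le_univ T₀)
      rw [← hTl]
      exact Nat.le_floor hθ.1
    obtain ⟨T, hT, hTc⟩ := Finset.exists_superset_card_eq hTs (by simpa using hsp)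
    refine ⟨T, hTc, fun j hj => ?_⟩
    by_contra h
    exact hj (hT (by simp [hT₀, h]))
  have hSmem : ∀ T : Finset (Fin p), T.card = s → ∀ c ∈ net T, c.1 ∈ S := by
    intro T hT c hc
    rw [hS, Finset.mem_biUnion]
    exact ⟨T, by simp [Finset.mem_powersetCard, hT], Finset.mem_image_of_mem _ hc⟩
  refine ⟨S, ?_, ?_, ?_, ?_⟩
  · obtain ⟨θ, hθ⟩ := sparseSphere_nonempty hp hk
    obtain ⟨T, hT, hθT⟩ := hext θ hθ
    obtain ⟨c, hc, -⟩ := hcov T ⟨θ, hθT⟩ hθ.2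
    exact ⟨c.1, hSmem T hT c hc⟩
  · calc S.card ≤ ∑ T ∈ Finset.univ.powersetCard s, ((net T).image Subtype.val).card :=
          Finset.card_biUnion_le
      _ ≤ ∑ T ∈ (Finset.univ : Finset (Fin p)).powersetCard s, 9 ^ s := by
          refine Finset.sum_le_sum fun T hT => Finset.card_image_le.trans ((hcard T).trans ?_)
          have := finrank_coordSubspace_le T
          rw [(Finset.mem_powersetCard.1 hT).2] at this
          exact Nat.pow_le_pow_right (by norm_num) this
      _ = p.choose s * 9 ^ s := by simp
      _ ≤ p ^ s * 9 ^ s := Nat.mul_le_mul_right _ (Nat.choose_le_pow _ _)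
      _ = (9 * p) ^ s := by rw [mul_pow, mul_comm]
  · intro c hc
    rw [hS, Finset.mem_biUnion] at hc
    obtain ⟨T, hT, hc⟩ := hc
    obtain ⟨v, hv, rfl⟩ := Finset.mem_image.1 hc
    exact hmem T (Finset.mem_powersetCard.1 hT).2 v (hnorm T v hv)
  · intro b Q₀ m hb hQ₀ hm θ hθ
    obtain ⟨T, hT, hθT⟩ := hext θ hθ
    exact abs_bilin_le_of_net (E := coordSubspace T)
      (b.domRestrict₁₂ (coordSubspace T) (coordSubspace T)) (fun v w => hb v w)
      (Q₀ := Q₀) (m := m) (fun v hv => hQ₀ v (hmem T hT v hv)) (net T) (hnorm T) (hcov T)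
      (fun c hc => hm c (hSmem T hT c hc)) ⟨θ, hθT⟩ hθ.2

/-! ### Symmetrization -/

lemma integrable_iSup_abs {Ω ι : Type*} [MeasurableSpace Ω] {μ : Measure Ω} [Fintype ι]
    [Nonempty ι] {F : ι → Ω → ℝ} (hF : ∀ t, Integrable (F t) μ) :
    Integrable (fun ω => ⨆ t, |F t ω|) μ := by
  have hb : ∀ ω, BddAbove (Set.range fun t => |F t ω|) := fun ω => (Set.finite_range _).bddAbove
  refine Integrable.mono' (integrable_finsetSum Finset.univ fun t _ => (hF t).abs) ?_ ?_
  · exact (AEMeasurable.iSup fun t => (hF t).aemeasurable.abs).aestronglyMeasurable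
  · refine Filter.Eventually.of_forall fun ω => ?_
    rw [Real.norm_eq_abs, abs_of_nonneg (Real.iSup_nonneg fun t => abs_nonneg _)]
    refine ciSup_le fun t => ?_
    exact Finset.single_le_sum (f := fun t => |F t ω|) (fun t _ => abs_nonneg _)
      (Finset.mem_univ t)

/-- Exchanging the `i`-th coordinates of two points for all `i` with `ε i = false`. -/
def coordSwap {n : ℕ} {S : Type*} (ε : Fin n → Bool) (z : (Fin n → S) × (Fin n → S)) :
    (Fin n → S) × (Fin n → S) :=
  (fun i => if ε i then z.1 i else z.2 i, fun i => if ε i then z.2 i else z.1 i)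

lemma measurePreserving_coordSwap {n : ℕ} {S : Type*} [MeasurableSpace S]
    (μ : Fin n → Measure S) [∀ i, IsProbabilityMeasure (μ i)] (ε : Fin n → Bool) :
    MeasurePreserving (coordSwap ε) ((Measure.pi μ).prod (Measure.pi μ))
      ((Measure.pi μ).prod (Measure.pi μ)) := by
  have e := measurePreserving_arrowProdEquivProdArrow S S (Fin n) μ μ
  have h : ∀ i, MeasurePreserving (fun q : S × S => if ε i then q else q.swap)
      ((μ i).prod (μ i)) ((μ i).prod (μ i)) := by
    intro i
    cases ε i
    · simpa using Measure.measurePreserving_swap (μ := μ i) (ν := μ i)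
    · exact MeasurePreserving.id ((μ i).prod (μ i))
  have h1 := (e.comp (measurePreserving_pi _ _ h)).comp (e.symm _)
  convert h1 using 1
  ext z i
  · simp only [coordSwap, Function.comp_apply, MeasurableEquiv.arrowProdEquivProdArrow,
      MeasurableEquiv.coe_mk, Equiv.arrowProdEquivProdArrow]
    cases hε : ε i <;> simp [hε]
  · simp only [coordSwap, Function.comp_apply, MeasurableEquiv.arrowProdEquivProdArrow,
      MeasurableEquiv.coe_mk, Equiv.arrowProdEquivProdArrow]
    cases hε : ε i <;> simp [hε]

lemma iSup_abs_le_add {ι : Type*} [Fintype ι] [Nonempty ι] {a b c : ι → ℝ}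
    (h : ∀ t, |a t| ≤ |b t| + |c t|) : (⨆ t, |a t|) ≤ (⨆ t, |b t|) + ⨆ t, |c t| :=
  ciSup_le fun t => (h t).trans (add_le_add
    (le_ciSup (f := fun t => |b t|) (Set.finite_range _).bddAbove t)
    (le_ciSup (f := fun t => |c t|) (Set.finite_range _).bddAbove t))

/-- Symmetrization on a product space. -/
lemma integral_pi_iSup_abs_sub_le {n : ℕ} {S ι : Type*} [MeasurableSpace S] [Fintype ι]
    [Nonempty ι] (μ : Fin n → Measure S) [∀ i, IsProbabilityMeasure (μ i)] (f : ι → S → ℝ)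
    (hf : ∀ t i, Integrable (f t) (μ i)) :
    ∫ x, (⨆ t, |∑ i, (f t (x i) - ∫ y, f t y ∂(μ i))|) ∂(Measure.pi μ) ≤
      2 * ∫ x, signMean (fun ε => ⨆ t, |signSum ε (fun i => f t (x i))|) ∂(Measure.pi μ) := by
  set Q := Measure.pi μ with hQ
  have hev : ∀ t i, Integrable (fun x : Fin n → S => f t (x i)) Q := fun t i =>
    (measurePreserving_eval μ i).integrable_comp_of_integrable (hf t i)
  have hevint : ∀ t i, ∫ x, f t (x i) ∂Q = ∫ y, f t y ∂(μ i) := fun t i => by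
    have hmap := (measurePreserving_eval μ i).map_eq
    have h := integral_map (μ := Q) (measurable_pi_apply i).aemeasurable (f := f t)
      (by rw [hQ]; exact hmap ▸ (hf t i).1)
    rw [← h, hQ]
    exact congrArg (fun ν => ∫ y, f t y ∂ν) hmap
  have hfst : ∀ t i, Integrable (fun z : (Fin n → S) × (Fin n → S) => f t (z.1 i)) (Q.prod Q) :=
    fun t i => (hev t i).comp_fst Q
  have hsnd : ∀ t i, Integrable (fun z : (Fin n → S) × (Fin n → S) => f t (z.2 i)) (Q.prod Q) :=
    fun t i => (hev t i).comp_snd Q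
  have hSig : ∀ ε : Fin n → Bool, Integrable
      (fun x => ⨆ t, |signSum ε (fun i => f t (x i))|) Q := fun ε =>
    integrable_iSup_abs fun t => integrable_finsetSum _ fun i _ => (hev t i).const_mul _
  -- replacing the means by an independent copy
  have hH : Integrable (fun z : (Fin n → S) × (Fin n → S) =>
      ⨆ t, |∑ i, (f t (z.1 i) - f t (z.2 i))|) (Q.prod Q) :=
    integrable_iSup_abs fun t => integrable_finsetSum _ fun i _ => (hfst t i).sub (hsnd t i)
  have h1 : ∫ x, (⨆ t, |∑ i, (f t (x i) - ∫ y, f t y ∂(μ i))|) ∂Q ≤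
      ∫ z, (⨆ t, |∑ i, (f t (z.1 i) - f t (z.2 i))|) ∂(Q.prod Q) := by
    rw [integral_prod _ hH]
    refine integral_mono (integrable_iSup_abs fun t => integrable_finsetSum _ fun i _ =>
      (hev t i).sub (integrable_const _)) hH.integral_prod_left fun x => ciSup_le fun t => ?_
    have hint : ∀ t, Integrable (fun y => ∑ i, (f t (x i) - f t (y i))) Q := fun t =>
      integrable_finsetSum _ fun i _ => (integrable_const _).sub (hev t i)
    calc |∑ i, (f t (x i) - ∫ y, f t y ∂(μ i))|
        = |∫ y, ∑ i, (f t (x i) - f t (y i)) ∂Q| := by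
          have hi : ∀ i ∈ Finset.univ, Integrable (fun y : Fin n → S => f t (x i) - f t (y i)) Q :=
            fun i _ => (integrable_const _).sub (hev t i)
          rw [integral_finsetSum _ hi]
          congr 1
          refine Finset.sum_congr rfl fun i _ => ?_
          rw [integral_sub (integrable_const _) (hev t i), hevint]
          simp
      _ ≤ ∫ y, |∑ i, (f t (x i) - f t (y i))| ∂Q := abs_integral_le_integral_abs
      _ ≤ _ := integral_mono (hint t).abs (integrable_iSup_abs hint) fun y =>
          le_ciSup (f := fun t => |∑ i, (f t (x i) - f t (y i))|) (Set.finite_range _).bddAbove t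
  -- exchanging coordinates with the copy introduces arbitrary signs
  have h2 : ∀ ε : Fin n → Bool,
      ∫ z, (⨆ t, |∑ i, (f t (z.1 i) - f t (z.2 i))|) ∂(Q.prod Q) ≤
        2 * ∫ x, (⨆ t, |signSum ε (fun i => f t (x i))|) ∂Q := by
    intro ε
    have hmp := measurePreserving_coordSwap μ ε
    have h3 : ∫ z, (⨆ t, |∑ i, (f t (z.1 i) - f t (z.2 i))|) ∂(Q.prod Q) =
        ∫ z, (⨆ t, |∑ i, (f t ((coordSwap ε z).1 i) - f t ((coordSwap ε z).2 i))|)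
          ∂(Q.prod Q) := by
      have h4 := integral_map (μ := Q.prod Q) hmp.measurable.aemeasurable
        (f := fun z : (Fin n → S) × (Fin n → S) => ⨆ t, |∑ i, (f t (z.1 i) - f t (z.2 i))|)
        (by rw [hmp.map_eq]; exact hH.1)
      rw [hmp.map_eq] at h4
      exact h4
    rw [h3]
    have h5 : ∀ z : (Fin n → S) × (Fin n → S),
        (⨆ t, |∑ i, (f t ((coordSwap ε z).1 i) - f t ((coordSwap ε z).2 i))|) ≤
        (⨆ t, |signSum ε (fun i => f t (z.1 i))|) + ⨆ t, |signSum ε (fun i => f t (z.2 i))| := by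
      intro z
      refine iSup_abs_le_add fun t => ?_
      have h6 : ∑ i, (f t ((coordSwap ε z).1 i) - f t ((coordSwap ε z).2 i)) =
          signSum ε (fun i => f t (z.1 i)) - signSum ε (fun i => f t (z.2 i)) := by
        rw [← signSum_sub, signSum]
        refine Finset.sum_congr rfl fun i _ => ?_
        simp only [coordSwap, signVal]
        cases ε i <;> simp
      rw [h6]
      exact abs_sub _ _
    calc _ ≤ ∫ z, ((⨆ t, |signSum ε (fun i => f t (z.1 i))|) +
          ⨆ t, |signSum ε (fun i => f t (z.2 i))|) ∂(Q.prod Q) := by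
          refine integral_mono ?_ (((hSig ε).comp_fst Q).add ((hSig ε).comp_snd Q)) h5
          exact hmp.integrable_comp_of_integrable hH
      _ = _ := by
          rw [integral_add ((hSig ε).comp_fst Q) ((hSig ε).comp_snd Q), two_mul]
          rw [integral_fun_fst (fun x : Fin n → S => ⨆ t, |signSum ε (fun i => f t (x i))|),
            integral_fun_snd (fun x : Fin n → S => ⨆ t, |signSum ε (fun i => f t (x i))|)]
          simp
  refine h1.trans ?_
  have h7 : ∫ x, signMean (fun ε => ⨆ t, |signSum ε (fun i => f t (x i))|) ∂Q =
      signMean (fun ε => ∫ x, (⨆ t, |signSum ε (fun i => f t (x i))|) ∂Q) := by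
    simp only [signMean]
    rw [integral_div, integral_finsetSum _ fun ε _ => hSig ε]
  rw [h7, ← signMean_mul_left, ← signMean_const n (∫ z, _ ∂(Q.prod Q))]
  exact signMean_mono h2

/-- Symmetrization for independent random variables. -/
lemma integral_iSup_abs_sub_le_signMean {Ω S ι : Type*} [MeasurableSpace Ω] {P : Measure Ω}
    [IsProbabilityMeasure P] [MeasurableSpace S] [Fintype ι] [Nonempty ι] {n : ℕ}
    (Y : Fin n → Ω → S) (hY : ∀ i, Measurable (Y i)) (hind : iIndepFun Y P) (f : ι → S → ℝ)
    (hfm : ∀ t, Measurable (f t)) (hf : ∀ t i, Integrable (fun ω => f t (Y i ω)) P) :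
    ∫ ω, (⨆ t, |∑ i, (f t (Y i ω) - ∫ ω', f t (Y i ω') ∂P)|) ∂P ≤
      2 * ∫ ω, signMean (fun ε => ⨆ t, |signSum ε (fun i => f t (Y i ω))|) ∂P := by
  have hprob : ∀ i, IsProbabilityMeasure (P.map (Y i)) := fun i =>
    Measure.isProbabilityMeasure_map (hY i).aemeasurable
  have hfi : ∀ t i, Integrable (f t) (P.map (Y i)) := fun t i =>
    (integrable_map_measure (hfm t).aestronglyMeasurable (hY i).aemeasurable).2 (hf t i)
  have hmap := (iIndepFun_iff_map_fun_eq_pi_map fun i => (hY i).aemeasurable).1 hind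
  have hYm : Measurable fun ω i => Y i ω := measurable_pi_lambda _ hY
  have hsym := integral_pi_iSup_abs_sub_le (fun i => P.map (Y i)) f hfi
  have hint : ∀ t i, ∫ y, f t y ∂(P.map (Y i)) = ∫ ω', f t (Y i ω') ∂P := fun t i =>
    integral_map (hY i).aemeasurable (hfm t).aestronglyMeasurable
  simp only [hint] at hsym
  have hfx : ∀ t i, Measurable fun x : Fin n → S => f t (x i) := fun t i =>
    (hfm t).comp (measurable_pi_apply i)
  rw [← hmap, integral_map hYm.aemeasurable, integral_map hYm.aemeasurable] at hsym
  · exact hsym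
  · refine Measurable.aestronglyMeasurable ?_
    unfold signMean signSum
    refine Measurable.div_const (Finset.measurable_fun_sum _ fun ε _ => Measurable.iSup fun t =>
      Measurable.abs (Finset.measurable_fun_sum _ fun i _ => (hfx t i).const_mul _)) _
  · exact (Measurable.iSup fun t => Measurable.abs
      (Finset.measurable_fun_sum _ fun i _ => (hfx t i).sub_const _)).aestronglyMeasurable

/-! ### The envelope of the data and integrability -/

/-- The squared envelope `max_{i, u} ‖X_{ui}‖_∞²`. -/
noncomputable def sqEnvelope {Ω U : Type*} {n p : ℕ} (X : U → Fin n → Ω → Fin p → ℝ) (ω : Ω) : ℝ :=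
  ⨆ i : Fin n, ⨆ u : U, ‖X u i ω‖ ^ 2

lemma sqEnvelope_nonneg {Ω U : Type*} {n p : ℕ} (X : U → Fin n → Ω → Fin p → ℝ) (ω : Ω) :
    0 ≤ sqEnvelope X ω :=
  Real.iSup_nonneg fun _ => Real.iSup_nonneg fun _ => sq_nonneg _

lemma abs_le_sqrt_sqEnvelope {Ω U : Type*} [Finite U] {n p : ℕ} (X : U → Fin n → Ω → Fin p → ℝ)
    (ω : Ω) (u : U) (i : Fin n) (j : Fin p) : |X u i ω j| ≤ √(sqEnvelope X ω) := by
  apply Real.le_sqrt_of_sq_le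
  calc |X u i ω j| ^ 2 ≤ ‖X u i ω‖ ^ 2 := by
        gcongr
        exact norm_le_pi_norm (X u i ω) j
    _ ≤ ⨆ u : U, ‖X u i ω‖ ^ 2 :=
        le_ciSup (f := fun u => ‖X u i ω‖ ^ 2) (Set.finite_range _).bddAbove u
    _ ≤ sqEnvelope X ω :=
        le_ciSup (f := fun i => ⨆ u : U, ‖X u i ω‖ ^ 2) (Set.finite_range _).bddAbove i

lemma abs_linForm_le_envelope {Ω U : Type*} [Finite U] {n p : ℕ}
    (X : U → Fin n → Ω → Fin p → ℝ) (ω : Ω) (u : U) (i : Fin n) (θ : EuclideanSpace ℝ (Fin p))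
    {r : ℝ} (hr : ∑ j, |θ j| ≤ r) : |linForm θ (X u i ω)| ≤ r * √(sqEnvelope X ω) :=
  abs_linForm_le θ (Real.sqrt_nonneg _) hr _ (abs_le_sqrt_sqEnvelope X ω u i)

lemma sq_linForm_le_envelope {Ω U : Type*} [Finite U] {n p : ℕ}
    (X : U → Fin n → Ω → Fin p → ℝ) (ω : Ω) (u : U) (i : Fin n) (θ : EuclideanSpace ℝ (Fin p))
    {r : ℝ} (hr : ∑ j, |θ j| ≤ r) : linForm θ (X u i ω) ^ 2 ≤ r ^ 2 * sqEnvelope X ω := by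
  have h := abs_linForm_le_envelope X ω u i θ hr
  calc linForm θ (X u i ω) ^ 2 = |linForm θ (X u i ω)| ^ 2 := (sq_abs _).symm
    _ ≤ (r * √(sqEnvelope X ω)) ^ 2 := by gcongr
    _ = _ := by rw [mul_pow, Real.sq_sqrt (sqEnvelope_nonneg X ω)]

lemma measurable_linForm {p : ℕ} (θ : EuclideanSpace ℝ (Fin p)) : Measurable (linForm θ) := by
  unfold linForm
  exact Finset.measurable_fun_sum _ fun j _ => (measurable_pi_apply j).const_mul _

lemma integrable_linForm_mul {Ω U : Type*} [MeasurableSpace Ω] {P : Measure Ω} [Finite U]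
    {n p : ℕ} {X : U → Fin n → Ω → Fin p → ℝ} (hX : ∀ u i, Measurable (X u i))
    (hE : Integrable (sqEnvelope X) P) (u : U) (i : Fin n) (θ η : EuclideanSpace ℝ (Fin p)) :
    Integrable (fun ω => linForm θ (X u i ω) * linForm η (X u i ω)) P := by
  refine (hE.const_mul ((∑ j, |θ j|) * ∑ j, |η j|)).mono'
    (((measurable_linForm θ).comp (hX u i)).mul
      ((measurable_linForm η).comp (hX u i))).aestronglyMeasurable ?_
  refine Filter.Eventually.of_forall fun ω => ?_
  have h1 := abs_linForm_le_envelope X ω u i θ le_rfl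
  have h2 := abs_linForm_le_envelope X ω u i η le_rfl
  rw [Real.norm_eq_abs, abs_mul]
  refine (mul_le_mul h1 h2 (abs_nonneg _) ((abs_nonneg _).trans h1)).trans_eq ?_
  have := Real.mul_self_sqrt (sqEnvelope_nonneg X ω)
  linear_combination ((∑ j, |θ j|) * ∑ j, |η j|) * this

lemma integrable_sq_linForm {Ω U : Type*} [MeasurableSpace Ω] {P : Measure Ω} [Finite U]
    {n p : ℕ} {X : U → Fin n → Ω → Fin p → ℝ} (hX : ∀ u i, Measurable (X u i))
    (hE : Integrable (sqEnvelope X) P) (u : U) (i : Fin n) (θ : EuclideanSpace ℝ (Fin p)) :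
    Integrable (fun ω => linForm θ (X u i ω) ^ 2) P := by
  simpa only [sq] using integrable_linForm_mul hX hE u i θ θ

lemma linForm_add {p : ℕ} (θ η : EuclideanSpace ℝ (Fin p)) (x : Fin p → ℝ) :
    linForm (θ + η) x = linForm θ x + linForm η x := by
  simp [linForm, add_mul, Finset.sum_add_distrib]

lemma linForm_smul {p : ℕ} (c : ℝ) (θ : EuclideanSpace ℝ (Fin p)) (x : Fin p → ℝ) :
    linForm (c • θ) x = c * linForm θ x := by
  simp [linForm, mul_assoc, Finset.mul_sum]

lemma empMean_add {n : ℕ} (a b : Fin n → ℝ) :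
    empMean (fun i => a i + b i) = empMean a + empMean b := by
  simp [empMean, Finset.sum_add_distrib, add_div]

lemma empMean_mul_left {n : ℕ} (c : ℝ) (a : Fin n → ℝ) :
    empMean (fun i => c * a i) = c * empMean a := by
  simp [empMean, ← Finset.mul_sum, mul_div_assoc]

/-! ### Reduction of the deviation to the net -/

/-- The centred empirical covariance form `(θ, η) ↦ 𝔼ₙ[(θ'X_u)(η'X_u) - E (θ'X_u)(η'X_u)]` at a
sample point. -/
noncomputable def covForm {Ω U : Type*} [MeasurableSpace Ω] {P : Measure Ω} [Finite U]
    {n p : ℕ} {X : U → Fin n → Ω → Fin p → ℝ} (hX : ∀ u i, Measurable (X u i))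
    (hE : Integrable (sqEnvelope X) P) (u : U) (ω : Ω) :
    EuclideanSpace ℝ (Fin p) →ₗ[ℝ] EuclideanSpace ℝ (Fin p) →ₗ[ℝ] ℝ :=
  LinearMap.mk₂ ℝ
    (fun θ η => empMean fun i => linForm θ (X u i ω) * linForm η (X u i ω) -
      ∫ ω', linForm θ (X u i ω') * linForm η (X u i ω') ∂P)
    (by
      intro θ₁ θ₂ η
      rw [← empMean_add]
      congr 1; ext i
      simp only [linForm_add, add_mul]
      rw [integral_add (integrable_linForm_mul hX hE u i θ₁ η)
        (integrable_linForm_mul hX hE u i θ₂ η)]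
      ring)
    (by
      intro c θ η
      rw [smul_eq_mul, ← empMean_mul_left]
      congr 1; ext i
      simp only [linForm_smul, mul_assoc]
      rw [integral_const_mul]
      ring)
    (by
      intro θ η₁ η₂
      rw [← empMean_add]
      congr 1; ext i
      simp only [linForm_add, mul_add]
      rw [integral_add (integrable_linForm_mul hX hE u i θ η₁)
        (integrable_linForm_mul hX hE u i θ η₂)]
      ring)
    (by
      intro c θ η
      rw [smul_eq_mul, ← empMean_mul_left]
      congr 1; ext i
      simp only [linForm_smul, mul_left_comm _ c]
      rw [integral_const_mul]
      ring)

lemma covForm_self {Ω U : Type*} [MeasurableSpace Ω] {P : Measure Ω} [Finite U]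
    {n p : ℕ} {X : U → Fin n → Ω → Fin p → ℝ} (hX : ∀ u i, Measurable (X u i))
    (hE : Integrable (sqEnvelope X) P) (u : U) (ω : Ω) (θ : EuclideanSpace ℝ (Fin p)) :
    covForm hX hE u ω θ θ = empMean fun i => linForm θ (X u i ω) ^ 2 -
      ∫ ω', linForm θ (X u i ω') ^ 2 ∂P := by
  simp [covForm, sq]

lemma covForm_symm {Ω U : Type*} [MeasurableSpace Ω] {P : Measure Ω} [Finite U]
    {n p : ℕ} {X : U → Fin n → Ω → Fin p → ℝ} (hX : ∀ u i, Measurable (X u i))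
    (hE : Integrable (sqEnvelope X) P) (u : U) (ω : Ω) (θ η : EuclideanSpace ℝ (Fin p)) :
    covForm hX hE u ω θ η = covForm hX hE u ω η θ := by
  simp [covForm, mul_comm]

lemma continuous_bilin_self {E : Type*} [NormedAddCommGroup E] [NormedSpace ℝ E]
    [FiniteDimensional ℝ E] (b : E →ₗ[ℝ] E →ₗ[ℝ] ℝ) : Continuous fun v => b v v := by
  have h : Continuous (LinearMap.toContinuousLinearMap.toLinearMap ∘ₗ b : E →ₗ[ℝ] E →L[ℝ] ℝ) :=
    LinearMap.continuous_of_finiteDimensional _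
  exact h.clm_apply continuous_id

lemma exists_abs_covForm_self_le {Ω U : Type*} [MeasurableSpace Ω] {P : Measure Ω} [Finite U]
    {n p : ℕ} {X : U → Fin n → Ω → Fin p → ℝ} (hX : ∀ u i, Measurable (X u i))
    (hE : Integrable (sqEnvelope X) P) (ω : Ω) :
    ∃ Q₀, ∀ u, ∀ θ : EuclideanSpace ℝ (Fin p), ‖θ‖ = 1 → |covForm hX hE u ω θ θ| ≤ Q₀ := by
  have h : ∀ u, ∃ Q₀, ∀ θ : EuclideanSpace ℝ (Fin p), ‖θ‖ = 1 →
      |covForm hX hE u ω θ θ| ≤ Q₀ := by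
    intro u
    obtain ⟨C, hC⟩ := (isCompact_sphere (0 : EuclideanSpace ℝ (Fin p)) 1).exists_bound_of_continuousOn
      (continuous_bilin_self (covForm hX hE u ω)).continuousOn
    exact ⟨C, fun θ hθ => hC θ (by simpa using hθ)⟩
  choose Q₀ hQ₀ using h
  obtain ⟨C, hC⟩ := (Set.finite_range Q₀).bddAbove
  exact ⟨C, fun u θ hθ => (hQ₀ u θ hθ).trans (hC ⟨u, rfl⟩)⟩

lemma sparseDeviation_eq {Ω U : Type*} [MeasurableSpace Ω] {P : Measure Ω} [Finite U]
    {n p : ℕ} {k : ℝ} {X : U → Fin n → Ω → Fin p → ℝ} (hX : ∀ u i, Measurable (X u i))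
    (hE : Integrable (sqEnvelope X) P) (ω : Ω) :
    sparseDeviation P k X ω =
      ⨆ θ : sparseSphere p k, ⨆ u : U, |covForm hX hE u ω θ.1 θ.1| := by
  simp only [covForm_self, sparseDeviation]

lemma measurable_sparseDeviation {Ω U : Type*} [MeasurableSpace Ω] {P : Measure Ω} [Finite U]
    [Nonempty U] {n p : ℕ} {k : ℝ} (hp : 1 ≤ p) (hk : 1 ≤ k) {X : U → Fin n → Ω → Fin p → ℝ}
    (hX : ∀ u i, Measurable (X u i)) (hE : Integrable (sqEnvelope X) P) :
    Measurable (sparseDeviation P k X) := by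
  have : Nonempty (sparseSphere p k) := (sparseSphere_nonempty hp hk).to_subtype
  -- by continuity in `θ`, a countable dense set of `θ` suffices
  have h : sparseDeviation P k X = fun ω => ⨆ l : ℕ, ⨆ u : U,
      |covForm hX hE u ω (TopologicalSpace.denseSeq (sparseSphere p k) l).1
        (TopologicalSpace.denseSeq (sparseSphere p k) l).1| := by
    ext ω
    rw [sparseDeviation_eq hX hE]
    obtain ⟨Q₀, hQ₀⟩ := exists_abs_covForm_self_le hX hE ω
    have hb : ∀ θ : sparseSphere p k, ⨆ u : U, |covForm hX hE u ω θ.1 θ.1| ≤ Q₀ := fun θ =>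
      ciSup_le fun u => hQ₀ u θ.1 θ.2.2
    have hbs : BddAbove (Set.range fun l : ℕ => ⨆ u : U,
        |covForm hX hE u ω (TopologicalSpace.denseSeq (sparseSphere p k) l).1
          (TopologicalSpace.denseSeq (sparseSphere p k) l).1|) :=
      ⟨Q₀, by rintro _ ⟨l, rfl⟩; exact hb _⟩
    apply le_antisymm
    · refine ciSup_le fun θ => ciSup_le fun u => ?_
      have hcl : IsClosed {θ : sparseSphere p k | |covForm hX hE u ω θ.1 θ.1| ≤
          ⨆ l : ℕ, ⨆ u : U, |covForm hX hE u ω (TopologicalSpace.denseSeq (sparseSphere p k) l).1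
            (TopologicalSpace.denseSeq (sparseSphere p k) l).1|} :=
        isClosed_le (((continuous_bilin_self _).comp continuous_subtype_val).abs) continuous_const
      have hsub := closure_minimal (s := Set.range
          (TopologicalSpace.denseSeq (sparseSphere p k))) (by
        rintro _ ⟨l, rfl⟩
        exact (le_ciSup (f := fun u => |covForm hX hE u ω
            (TopologicalSpace.denseSeq (sparseSphere p k) l).1
            (TopologicalSpace.denseSeq (sparseSphere p k) l).1|)
          (Set.finite_range _).bddAbove u).trans (le_ciSup hbs l)) hcl
      exact hsub ((TopologicalSpace.denseRange_denseSeq (sparseSphere p k)) θ)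
    · exact ciSup_le fun l => le_ciSup
        (f := fun θ : sparseSphere p k => ⨆ u : U, |covForm hX hE u ω θ.1 θ.1|)
        ⟨Q₀, by rintro _ ⟨θ, rfl⟩; exact hb θ⟩ _
  rw [h]
  refine Measurable.iSup fun l => Measurable.iSup fun u => Measurable.abs ?_
  simp only [covForm_self, empMean]
  exact Measurable.div_const (Finset.measurable_fun_sum _ fun i _ =>
    (((measurable_linForm _).comp (hX u i)).pow_const 2).sub_const _) _

/-- The deviation over the sparse sphere is at most twice the deviation over a net. -/
lemma sparseDeviation_le_net {Ω U : Type*} [MeasurableSpace Ω] {P : Measure Ω} [Finite U]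
    [Nonempty U] {n p : ℕ} {k : ℝ} (hp : 1 ≤ p) (hk : 1 ≤ k) {X : U → Fin n → Ω → Fin p → ℝ}
    (hX : ∀ u i, Measurable (X u i)) (hE : Integrable (sqEnvelope X) P)
    (S : Finset (EuclideanSpace ℝ (Fin p)))
    (hS : ∀ (b : EuclideanSpace ℝ (Fin p) →ₗ[ℝ] EuclideanSpace ℝ (Fin p) →ₗ[ℝ] ℝ) (Q₀ m : ℝ),
        (∀ v w, b v w = b w v) → (∀ θ ∈ sparseSphere p k, |b θ θ| ≤ Q₀) →
        (∀ c ∈ S, |b c c| ≤ m) → ∀ θ ∈ sparseSphere p k, |b θ θ| ≤ 2 * m) (ω : Ω) :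
    sparseDeviation P k X ω ≤ 2 / n * ⨆ t : S × U, |∑ i, (linForm t.1.1 (X t.2 i ω) ^ 2 -
      ∫ ω', linForm t.1.1 (X t.2 i ω') ^ 2 ∂P)| := by
  have : Nonempty (sparseSphere p k) := (sparseSphere_nonempty hp hk).to_subtype
  rw [sparseDeviation_eq hX hE]
  obtain ⟨Q₀, hQ₀⟩ := exists_abs_covForm_self_le hX hE ω
  refine ciSup_le fun θ => ciSup_le fun u => ?_
  have h := hS (covForm hX hE u ω) Q₀ ((⨆ t : S × U, |∑ i, (linForm t.1.1 (X t.2 i ω) ^ 2 -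
      ∫ ω', linForm t.1.1 (X t.2 i ω') ^ 2 ∂P)|) / n) (covForm_symm hX hE u ω)
      (fun θ hθ => hQ₀ u θ hθ.2) (fun c hc => by
        rw [covForm_self, empMean, abs_div, Nat.abs_cast]
        gcongr
        exact le_ciSup (f := fun t : S × U => |∑ i, (linForm t.1.1 (X t.2 i ω) ^ 2 -
          ∫ ω', linForm t.1.1 (X t.2 i ω') ^ 2 ∂P)|) (Set.finite_range _).bddAbove
          (⟨c, hc⟩, u)) θ.1 θ.2
  refine h.trans_eq ?_
  ring

/-! ### The self-bounding inequality -/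

lemma integral_mul_le_sqrt_mul_sqrt {Ω : Type*} [MeasurableSpace Ω] {P : Measure Ω}
    {f g : Ω → ℝ} (hf0 : ∀ ω, 0 ≤ f ω) (hg0 : ∀ ω, 0 ≤ g ω)
    (hf : MemLp f 2 P) (hg : MemLp g 2 P) :
    ∫ ω, f ω * g ω ∂P ≤ √(∫ ω, f ω ^ 2 ∂P) * √(∫ ω, g ω ^ 2 ∂P) := by
  have h := integral_mul_le_Lp_mul_Lq_of_nonneg (μ := P) (p := 2) (q := 2)
    Real.HolderConjugate.two_two (Filter.Eventually.of_forall hf0)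
    (Filter.Eventually.of_forall hg0) (by simpa using hf) (by simpa using hg)
  simpa [Real.sqrt_eq_rpow] using h

/-- A quantity bounded by `D √(W + σ²)` absorbs itself. -/
lemma le_of_le_mul_sqrt_add {W D σ : ℝ} (hW : 0 ≤ W) (hD : 0 ≤ D) (hσ : 0 ≤ σ)
    (h : W ≤ D * √(W + σ ^ 2)) : W ≤ D ^ 2 + D * σ := by
  have h1 : W ^ 2 ≤ D ^ 2 * (W + σ ^ 2) := by
    calc W ^ 2 ≤ (D * √(W + σ ^ 2)) ^ 2 := by gcongr
      _ = _ := by rw [mul_pow, Real.sq_sqrt (by positivity)]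
  by_contra! hcon
  have hDσ : 0 ≤ D * σ := mul_nonneg hD hσ
  have h2 : D * σ ≤ W := by nlinarith [sq_nonneg D]
  have hWpos : 0 < W := by nlinarith [sq_nonneg D]
  nlinarith [mul_lt_mul_of_pos_left hcon hWpos, mul_le_mul_of_nonneg_right h2 hDσ]

/-- The bound on the net in terms of itself: symmetrization, the conditional entropy bound and
the Cauchy–Schwarz inequality. -/
lemma integral_iSup_net_le {Ω U : Type*} [MeasurableSpace Ω] {P : Measure Ω}
    [IsProbabilityMeasure P] [Fintype U] [Nonempty U] {n p : ℕ} {k K σ : ℝ}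
    {X : U → Fin n → Ω → Fin p → ℝ} (hn : 1 ≤ n) (hp : 2 ≤ p) (hk : 1 ≤ k)
    (hX : ∀ u i, Measurable (X u i))
    (hind : iIndepFun (fun (i : Fin n) (ω : Ω) (u : U) => X u i ω) P)
    (hE : Integrable (sqEnvelope X) P) (hK : √(∫ ω, sqEnvelope X ω ∂P) ≤ K)
    (S : Finset (EuclideanSpace ℝ (Fin p))) (hSne : S.Nonempty)
    (hScard : S.card ≤ (9 * p) ^ (min ⌊k⌋₊ p)) (hSsub : ∀ c ∈ S, c ∈ sparseSphere p k)
    (hσ : ∀ c ∈ S, ∀ u, ∑ i, ∫ ω, linForm c (X u i ω) ^ 2 ∂P ≤ n * σ ^ 2) :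
    ∫ ω, (⨆ t : S × U, |∑ i, (linForm t.1.1 (X t.2 i ω) ^ 2 -
        ∫ ω', linForm t.1.1 (X t.2 i ω') ^ 2 ∂P)|) ∂P ≤
      1080 * (K * √k * (√(Real.log (Fintype.card U)) + √(Real.log p) +
        Real.log k * √(Real.log p) * √(Real.log n))) *
      √((∫ ω, (⨆ t : S × U, |∑ i, (linForm t.1.1 (X t.2 i ω) ^ 2 -
        ∫ ω', linForm t.1.1 (X t.2 i ω') ^ 2 ∂P)|) ∂P) + n * σ ^ 2) := by
  have hSne' : Nonempty S := hSne.to_subtype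
  set s := min ⌊k⌋₊ p with hs
  have hs1 : 1 ≤ s := le_min (Nat.one_le_floor_iff k |>.2 hk) (by omega)
  have hsk : (s : ℝ) ≤ k :=
    le_trans (by exact_mod_cast min_le_left _ _) (Nat.floor_le (by linarith))
  have hs1' : (1 : ℝ) ≤ s := by exact_mod_cast hs1
  have hK0 : 0 ≤ K := (Real.sqrt_nonneg _).trans hK
  set Ls := √(Real.log (Fintype.card U)) + √(Real.log p) +
    Real.log s * √(Real.log p) * √(Real.log n) with hLs
  set L := √(Real.log (Fintype.card U)) + √(Real.log p) +
    Real.log k * √(Real.log p) * √(Real.log n) with hL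
  have hlogs : Real.log s ≤ Real.log k := Real.log_le_log (by linarith) hsk
  have hlogs0 : 0 ≤ Real.log s := Real.log_nonneg hs1'
  have hLL : Ls ≤ L := by simp only [hLs, hL]; gcongr
  have hLs0 : 0 ≤ Ls := by positivity
  have hL0 : 0 ≤ L := hLs0.trans hLL
  set D : Ω → ℝ := fun ω => ⨆ t : S × U, |∑ i, (linForm t.1.1 (X t.2 i ω) ^ 2 -
        ∫ ω', linForm t.1.1 (X t.2 i ω') ^ 2 ∂P)| with hD
  have hsq : ∀ (t : S × U) i, Integrable (fun ω => linForm t.1.1 (X t.2 i ω) ^ 2) P :=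
    fun t i => integrable_sq_linForm hX hE t.2 i t.1.1
  have hDint : Integrable D P := integrable_iSup_abs fun t => integrable_finsetSum _ fun i _ =>
    (hsq t i).sub (integrable_const _)
  -- `T` is the squared weak radius `max_t ∑ᵢ (θ'X_{ui})²`
  set T : Ω → ℝ := fun ω => ⨆ t : S × U, |∑ i, linForm t.1.1 (X t.2 i ω) ^ 2| with hT
  have hTint : Integrable T P := integrable_iSup_abs fun t => integrable_finsetSum _ fun i _ =>
    hsq t i
  have hT0 : ∀ ω, 0 ≤ T ω := fun ω => Real.iSup_nonneg fun t => abs_nonneg _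
  have hTD : ∀ ω, T ω ≤ D ω + n * σ ^ 2 := by
    intro ω
    refine ciSup_le fun t => ?_
    have h1 := le_ciSup (f := fun t : S × U => |∑ i, (linForm t.1.1 (X t.2 i ω) ^ 2 -
        ∫ ω', linForm t.1.1 (X t.2 i ω') ^ 2 ∂P)|) (Set.finite_range _).bddAbove t
    have h2 := hσ t.1.1 t.1.2 t.2
    rw [abs_of_nonneg (Finset.sum_nonneg fun i _ => sq_nonneg _)]
    have h3 := (le_abs_self _).trans h1
    rw [Finset.sum_sub_distrib] at h3
    have h4 : (⨆ t : S × U, |∑ i, (linForm t.1.1 (X t.2 i ω) ^ 2 -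
        ∫ ω', linForm t.1.1 (X t.2 i ω') ^ 2 ∂P)|) = D ω := rfl
    linarith
  have hTW : ∫ ω, T ω ∂P ≤ ∫ ω, D ω ∂P + n * σ ^ 2 := by
    calc ∫ ω, T ω ∂P ≤ ∫ ω, (D ω + n * σ ^ 2) ∂P :=
          integral_mono hTint (hDint.add (integrable_const _)) hTD
      _ = _ := by rw [integral_add hDint (integrable_const _)]; simp
  have hsymm := integral_iSup_abs_sub_le_signMean (ι := S × U) (P := P)
    (fun (i : Fin n) (ω : Ω) (u : U) => X u i ω)
    (fun i => measurable_pi_lambda _ fun u => hX u i) hind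
    (fun t x => linForm t.1.1 (x t.2) ^ 2)
    (fun t => ((measurable_linForm _).comp (measurable_pi_apply t.2)).pow_const 2) hsq
  have hcond : ∀ ω, signMean (fun ε => ⨆ t : S × U,
      |signSum ε (fun i => linForm t.1.1 (X t.2 i ω) ^ 2)|) ≤
      540 * √s * Ls * (√(sqEnvelope X ω) * √(T ω)) := by
    intro ω
    refine (signMean_iSup_sq_linForm_le hp hn hs1 (fun c : S => c.1)
      (fun c => sum_abs_le_of_mem_sparseSphere (hSsub c.1 c.2)) (by simpa using hScard)
      (fun u i => X u i ω) (Real.sqrt_nonneg (sqEnvelope X ω)) (Real.sqrt_nonneg (T ω))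
      (fun u i j => abs_le_sqrt_sqEnvelope X ω u i j) ?_).trans_eq (by rw [hLs]; ring)
    intro c u
    rw [Real.sq_sqrt (hT0 ω)]
    exact (le_abs_self _).trans (le_ciSup (f := fun t : S × U =>
      |∑ i, linForm t.1.1 (X t.2 i ω) ^ 2|) (Set.finite_range _).bddAbove (c, u))
  have hZmem : MemLp (fun ω => √(sqEnvelope X ω)) 2 P := by
    rw [memLp_two_iff_integrable_sq hE.aemeasurable.sqrt.aestronglyMeasurable]
    simpa only [Real.sq_sqrt (sqEnvelope_nonneg X _)] using hE
  have hTmem : MemLp (fun ω => √(T ω)) 2 P := by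
    rw [memLp_two_iff_integrable_sq hTint.aemeasurable.sqrt.aestronglyMeasurable]
    simpa only [Real.sq_sqrt (hT0 _)] using hTint
  have hCS := integral_mul_le_sqrt_mul_sqrt (fun ω => Real.sqrt_nonneg (sqEnvelope X ω))
    (fun ω => Real.sqrt_nonneg (T ω)) hZmem hTmem
  simp only [Real.sq_sqrt (hT0 _), Real.sq_sqrt (sqEnvelope_nonneg X _)] at hCS
  have hmean : ∫ ω, signMean (fun ε => ⨆ t : S × U,
      |signSum ε (fun i => linForm t.1.1 (X t.2 i ω) ^ 2)|) ∂P ≤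
      540 * √s * Ls * ∫ ω, √(sqEnvelope X ω) * √(T ω) ∂P := by
    rw [← integral_const_mul]
    refine integral_mono_of_nonneg (Filter.Eventually.of_forall fun ω =>
      signMean_nonneg fun ε => Real.iSup_nonneg fun t => abs_nonneg _) ?_
      (Filter.Eventually.of_forall hcond)
    exact (hZmem.integrable_mul hTmem).const_mul _
  calc ∫ ω, D ω ∂P ≤ 2 * (540 * √s * Ls * (√(∫ ω, sqEnvelope X ω ∂P) * √(∫ ω, T ω ∂P))) := by
        refine hsymm.trans ?_
        gcongr
        exact hmean.trans (by gcongr)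
    _ ≤ 2 * (540 * √k * L * (K * √(∫ ω, D ω ∂P + n * σ ^ 2))) := by gcongr
    _ = _ := by ring

theorem mainTheorem11 :
    ∃ C : ℝ, 0 < C ∧
      ∀ (Ω : Type*) [MeasurableSpace Ω] (P : Measure Ω) [IsProbabilityMeasure P]
        (U : Type*) [Fintype U] [Nonempty U] (n p : ℕ) (k K : ℝ)
        (X : U → Fin n → Ω → Fin p → ℝ),
        1 ≤ n → 2 ≤ p → 1 ≤ k →
        (∀ u i, Measurable (X u i)) →
        iIndepFun (fun (i : Fin n) (ω : Ω) (u : U) => X u i ω) P →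
        -- on `Fin p → ℝ` the norm `‖·‖` is the sup norm
        Integrable (fun ω => (⨆ i : Fin n, ⨆ u : U, ‖X u i ω‖ ^ 2)) P →
        √(∫ ω, (⨆ i : Fin n, ⨆ u : U, ‖X u i ω‖ ^ 2) ∂P) ≤ K →
        Integrable (sparseDeviation P k X) P ∧
        ∫ ω, sparseDeviation P k X ω ∂P ≤
          C * (deltaRate K k n p (Fintype.card U) ^ 2 +
            deltaRate K k n p (Fintype.card U) *
              ⨆ τ : sparseSphere p k × U,
                √(empMean fun i => ∫ ω, linForm τ.1.1 (X τ.2 i ω) ^ 2 ∂P)) := by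
  refine ⟨2 * 1080 ^ 2, by norm_num, ?_⟩
  intro Ω _ P _ U _ _ n p k K X hn hp hk hX hind hE hK
  have hn0 : (0 : ℝ) < n := by exact_mod_cast hn
  have hK0 : 0 ≤ K := (Real.sqrt_nonneg _).trans hK
  change Integrable (sqEnvelope X) P at hE
  obtain ⟨S, hSne, hScard, hSsub, hSnet⟩ :=
    exists_finset_net_sparseSphere (p := p) (k := k) (by omega) hk
  have hSne' : Nonempty S := hSne.to_subtype
  set σ := ⨆ τ : sparseSphere p k × U,
    √(empMean fun i => ∫ ω, linForm τ.1.1 (X τ.2 i ω) ^ 2 ∂P) with hσ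
  have hσ0 : 0 ≤ σ := Real.iSup_nonneg fun _ => Real.sqrt_nonneg _
  have hσbdd : BddAbove (Set.range fun τ : sparseSphere p k × U =>
      √(empMean fun i => ∫ ω, linForm τ.1.1 (X τ.2 i ω) ^ 2 ∂P)) := by
    refine ⟨√(√(min ⌊k⌋₊ p : ℕ) ^ 2 * ∫ ω, sqEnvelope X ω ∂P), ?_⟩
    rintro _ ⟨τ, rfl⟩
    apply Real.sqrt_le_sqrt
    rw [empMean, div_le_iff₀ hn0]
    calc ∑ i, ∫ ω, linForm τ.1.1 (X τ.2 i ω) ^ 2 ∂P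
        ≤ ∑ _i : Fin n, √(min ⌊k⌋₊ p : ℕ) ^ 2 * ∫ ω, sqEnvelope X ω ∂P := by
          refine Finset.sum_le_sum fun i _ => ?_
          rw [← integral_const_mul]
          exact integral_mono (integrable_sq_linForm hX hE _ _ _) (hE.const_mul _) fun ω =>
            sq_linForm_le_envelope X ω _ _ _ (sum_abs_le_of_mem_sparseSphere τ.1.2)
      _ = _ := by
          rw [Finset.sum_const, Finset.card_univ, Fintype.card_fin, nsmul_eq_mul]; ring
  have hσS : ∀ c ∈ S, ∀ u, ∑ i, ∫ ω, linForm c (X u i ω) ^ 2 ∂P ≤ n * σ ^ 2 := by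
    intro c hc u
    have h1 : √(empMean fun i => ∫ ω, linForm c (X u i ω) ^ 2 ∂P) ≤ σ :=
      le_ciSup hσbdd (⟨c, hSsub c hc⟩, u)
    rw [Real.sqrt_le_left hσ0, empMean, div_le_iff₀ hn0] at h1
    linarith
  set D : Ω → ℝ := fun ω => ⨆ t : S × U, |∑ i, (linForm t.1.1 (X t.2 i ω) ^ 2 -
        ∫ ω', linForm t.1.1 (X t.2 i ω') ^ 2 ∂P)| with hD
  have hDint : Integrable D P := integrable_iSup_abs fun t => integrable_finsetSum _ fun i _ =>
    (integrable_sq_linForm hX hE t.2 i t.1.1).sub (integrable_const _)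
  have hD0 : 0 ≤ ∫ ω, D ω ∂P :=
    integral_nonneg fun ω => Real.iSup_nonneg fun _ => abs_nonneg _
  have hle : ∀ ω, sparseDeviation P k X ω ≤ 2 / n * D ω :=
    sparseDeviation_le_net (by omega) hk hX hE S hSnet
  have hnn : ∀ ω, 0 ≤ sparseDeviation P k X ω := fun ω =>
    Real.iSup_nonneg fun _ => Real.iSup_nonneg fun _ => abs_nonneg _
  have hint : Integrable (sparseDeviation P k X) P :=
    (hDint.const_mul (2 / (n : ℝ))).mono'
      (measurable_sparseDeviation (by omega) hk hX hE).aestronglyMeasurable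
      (Filter.Eventually.of_forall fun ω => by
        rw [Real.norm_eq_abs, abs_of_nonneg (hnn ω)]; exact hle ω)
  refine ⟨hint, ?_⟩
  have hself := integral_iSup_net_le hn hp hk hX hind hE hK S hSne hScard hSsub hσS
  set δ := deltaRate K k n p (Fintype.card U) with hδ
  have hδ0 : 0 ≤ δ := by
    have := Real.log_nonneg hk
    rw [hδ, deltaRate]
    positivity
  have hδn : K * √k * (√(Real.log (Fintype.card U)) + √(Real.log p) +
      Real.log k * √(Real.log p) * √(Real.log n)) = δ * √n := by
    rw [hδ, deltaRate]
    have : √(n : ℝ) ≠ 0 := by positivity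
    field_simp
  rw [hδn] at hself
  change ∫ ω, D ω ∂P ≤ 1080 * (δ * √n) * √(∫ ω, D ω ∂P + n * σ ^ 2) at hself
  -- division by `n` turns the bound into one for `W = E D / n`
  have hW : (∫ ω, D ω ∂P) / n ≤ 1080 * δ * √((∫ ω, D ω ∂P) / n + σ ^ 2) := by
    rw [div_le_iff₀ hn0]
    refine hself.trans_eq ?_
    have h1 : ∫ ω, D ω ∂P + n * σ ^ 2 = n * ((∫ ω, D ω ∂P) / n + σ ^ 2) := by field_simp
    rw [h1, Real.sqrt_mul hn0.le]
    have h2 := Real.mul_self_sqrt hn0.le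
    linear_combination (1080 * δ * √((∫ ω, D ω ∂P) / n + σ ^ 2)) * h2
  have hfin := le_of_le_mul_sqrt_add (by positivity) (by positivity) hσ0 hW
  calc ∫ ω, sparseDeviation P k X ω ∂P ≤ ∫ ω, 2 / n * D ω ∂P :=
        integral_mono hint (hDint.const_mul _) hle
    _ = 2 * ((∫ ω, D ω ∂P) / n) := by rw [integral_const_mul]; ring
    _ ≤ 2 * ((1080 * δ) ^ 2 + 1080 * δ * σ) := by gcongr
    _ ≤ _ := by nlinarith [mul_nonneg hδ0 hσ0]
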